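/- Let $N\in\mathbb N$, $\mathcal H=L^2(\mathbb R^N)$ and let $\mathfrak S(\mathbb R^N)\subset\mathcal H$ be the space of Schwartz functions, on which $Q_i$ is multiplication by $q_i$ and $P_i=-i\,\partial/\partial q_i$ ($i=1,\dots,N$). For multi-indices put $Q^\alpha=Q_1^{\alpha_1}\cdots Q_N^{\alpha_N}$ and $P^\beta=P_1^{\beta_1}\cdots P_N^{\beta_N}$. A bounded operator $T$ on $\mathcal H$ is called a Schwartz operator if for all multi-indices $\alpha,\alpha',\beta,\beta'\in\mathbb N_0^N$ $$\|T\|_{\alpha,\alpha',\beta,\beta'}:=\sup\bigl\{|\langle P^\beta Q^\alpha\psi\,|\,T P^{\beta'}Q^{\alpha'}\varphi\rangle| \;:\; \psi,\varphi\in\mathfrak S(\mathbb R^N),\ \|\psi\|\le 1,\ \|\varphi\|\le 1\bigr\}<\infty .$$ Let $\mathcal S(\mathcal H)$ be the space of Schwartz operators with the locally convex topology given by these seminorms, and let $\mathcal S'(\mathcal H)$ be the space of all continuous linear functionals $\mathcal S(\mathcal H)\to\mathbb C$. For all (noncommutative) polynomials $P_L,P_R$ in $Q_1,\dots,Q_N,P_1,\dots,P_N$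 with complex coefficients and all $T\in\mathcal S(\mathcal H)$, the operator $P_L T P_R$ is well defined on $\mathfrak S(\mathbb R^N)$ (that is, $TP_R\varphi\in\mathfrak S(\mathbb R^N)$ for all $\varphi\in\mathfrak S(\mathbb R^N)$) and has a unique bounded extension to $\mathcal H$, again denoted by $P_LTP_R$. With this notation, the following hold. 1. For every Hilbert–Schmidt operator $A$ on $\mathcal H$ and all polynomials $P_L,P_R$ in $Q_1,\dots,Q_N,P_1,\dots,P_N$, the operator $A\,(P_LTP_R)$ is trace class for every $T\in\mathcal S(\mathcal H)$, and the formula $$\Phi(T):=\operatorname{tr}[A\,(P_L T P_R)],\qquad T\in\mathcal S(\mathcal H),$$ defines an element $\Phi$ of $\mathcal S'(\mathcal H)$. 2. Conversely, for every $\Phi\in\mathcal S'(\mathcal H)$ there are a Hilbert–Schmidt operator $A$ on $\mathcal H$ and polynomials $P_L,P_R$ in $Q_1,\dots,Q_N,P_1,\dots,P_N$ such that $A\,(P_LTP_R)$ is trace class and $\Phi(T)=\operatorname{tr}[A\,(P_LTP_R)]$ for all $T\in\mathcal S(\mathcal H)$. -/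

import Mathlib

open MeasureTheory
open scoped SchwartzMap

noncomputable section

namespace SchwartzOperators

/-! ### Position, momentum and their polynomials on Schwartz functions -/

/-- The configuration space `ℝ^N` with its Euclidean structure and Lebesgue measure. -/
abbrev Conf (N : ℕ) : Type := EuclideanSpace ℝ (Fin N)

/-- The Hilbert space `L²(ℝ^N)`. -/
abbrev Hil (N : ℕ) : Type := Lp ℂ 2 (volume : Measure (Conf N))

/-- The space of Schwartz functions on `ℝ^N`. -/
abbrev SFun (N : ℕ) : Type := 𝓢(Conf N, ℂ)

/-- A Schwartz function as a vector of `L²(ℝ^N)`. -/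
abbrev vec {N : ℕ} (φ : SFun N) : Hil N := φ.toLp 2 volume

/-- The position operator `(Q_i φ)(q) = q_i φ(q)` on Schwartz functions. -/
def posOp {N : ℕ} (i : Fin N) : SFun N →L[ℂ] SFun N :=
  SchwartzMap.smulLeftCLM ℂ (fun q : Conf N => ((q i : ℝ) : ℂ))

/-- The momentum operator `P_i φ = -i ∂φ/∂q_i` on Schwartz functions. -/
def momOp {N : ℕ} (i : Fin N) : SFun N →L[ℂ] SFun N :=
  (-Complex.I) • LineDeriv.lineDerivOpCLM ℂ (SFun N) (EuclideanSpace.single i (1 : ℝ) : Conf N)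

theorem posOp_apply {N : ℕ} (i : Fin N) (φ : SFun N) (q : Conf N) :
    posOp i φ q = ((q i : ℝ) : ℂ) * φ q := by
  have h : (fun q : Conf N => ((q i : ℝ) : ℂ)).HasTemperateGrowth :=
    (Complex.ofRealCLM ∘L (EuclideanSpace.proj i : Conf N →L[ℝ] ℝ)).hasTemperateGrowth
  rw [posOp, SchwartzMap.smulLeftCLM_apply_apply h, smul_eq_mul]

theorem momOp_apply {N : ℕ} (i : Fin N) (φ : SFun N) (q : Conf N) :
    momOp i φ q = -Complex.I * lineDeriv ℝ φ q (EuclideanSpace.single i 1) := by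
  rw [← SchwartzMap.lineDerivOp_apply]
  rfl

/-- The monomial `Q^α = Q_1^{α_1} ⋯ Q_N^{α_N}`. -/
def posMon {N : ℕ} (α : Fin N → ℕ) : SFun N →L[ℂ] SFun N :=
  (List.ofFn fun i => posOp i ^ α i).prod

/-- The monomial `P^β = P_1^{β_1} ⋯ P_N^{β_N}`. -/
def momMon {N : ℕ} (β : Fin N → ℕ) : SFun N →L[ℂ] SFun N :=
  (List.ofFn fun i => momOp i ^ β i).prod

/-- The polynomial `f(Q, P)` in the (noncommuting) operators `Q_1, …, Q_N, P_1, …, P_N`; the letter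
`Sum.inl i` stands for `Q_i` and the letter `Sum.inr i` for `P_i`. -/
def polyOp {N : ℕ} (f : FreeAlgebra ℂ (Fin N ⊕ Fin N)) : SFun N →L[ℂ] SFun N :=
  FreeAlgebra.lift ℂ (Sum.elim posOp momOp : Fin N ⊕ Fin N → SFun N →L[ℂ] SFun N) f

/-! ### Schwartz operators -/

/-- The sesquilinear form `(ψ, φ) ↦ ⟨P^β Q^α ψ | T P^β' Q^α' φ⟩` on Schwartz functions, where the
multi-indices are given as `m = (α, α', β, β')`. -/
def form {N : ℕ} (m : (Fin N → ℕ) × (Fin N → ℕ) × (Fin N → ℕ) × (Fin N → ℕ))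
    (T : Hil N →L[ℂ] Hil N) (ψ φ : SFun N) : ℂ :=
  inner ℂ (vec (momMon m.2.2.1 (posMon m.1 ψ))) (T (vec (momMon m.2.2.2 (posMon m.2.1 φ))))

/-- Pairs of Schwartz functions in the unit ball of `L²(ℝ^N)`. -/
abbrev UnitPair (N : ℕ) : Type := {x : SFun N × SFun N // ‖vec x.1‖ ≤ 1 ∧ ‖vec x.2‖ ≤ 1}

instance (N : ℕ) : Nonempty (UnitPair N) :=
  ⟨⟨(0, 0), by
    have h : vec (0 : SFun N) = 0 := (SchwartzMap.toLpCLM ℂ ℂ 2 (volume : Measure (Conf N))).map_zero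
    constructor <;> simp [h]⟩⟩

/-- `T` is a Schwartz operator: for all `m = (α, α', β, β')`, the supremum of
`|⟨P^β Q^α ψ | T P^β' Q^α' φ⟩|` over Schwartz functions `ψ, φ` of `L²`-norm at most one is finite. -/
def IsSchwartz {N : ℕ} (T : Hil N →L[ℂ] Hil N) : Prop :=
  ∀ m, BddAbove (Set.range fun x : UnitPair N => ‖form m T x.1.1 x.1.2‖)

theorem form_add {N : ℕ} (m) (T S : Hil N →L[ℂ] Hil N) (ψ φ : SFun N) :
    form m (T + S) ψ φ = form m T ψ φ + form m S ψ φ := by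
  simp only [form, add_apply, inner_add_right]

theorem form_smul {N : ℕ} (m) (c : ℂ) (T : Hil N →L[ℂ] Hil N) (ψ φ : SFun N) :
    form m (c • T) ψ φ = c * form m T ψ φ := by
  simp only [form, smul_apply, inner_smul_right]

/-- The Schwartz operators as a linear subspace of the bounded operators on `L²(ℝ^N)`. -/
def schwartzOpSubmodule (N : ℕ) : Submodule ℂ (Hil N →L[ℂ] Hil N) where
  carrier := {T | IsSchwartz T}
  zero_mem' m := by
    refine ⟨0, ?_⟩
    rintro _ ⟨x, rfl⟩
    simp [form]
  add_mem' {T S} hT hS m := by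
    obtain ⟨a, ha⟩ := hT m
    obtain ⟨b, hb⟩ := hS m
    refine ⟨a + b, ?_⟩
    rintro _ ⟨x, rfl⟩
    simp only [form_add]
    exact (norm_add_le _ _).trans (add_le_add (ha ⟨x, rfl⟩) (hb ⟨x, rfl⟩))
  smul_mem' c T hT m := by
    obtain ⟨a, ha⟩ := hT m
    refine ⟨‖c‖ * a, ?_⟩
    rintro _ ⟨x, rfl⟩
    simp only [form_smul, norm_mul]
    exact mul_le_mul_of_nonneg_left (ha ⟨x, rfl⟩) (norm_nonneg c)

/-- The vector space of Schwartz operators on `L²(ℝ^N)`. It is a type synonym of the subspace of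
bounded operators, because its topology is not the one of the operator norm. -/
def SOp (N : ℕ) : Type := schwartzOpSubmodule N

instance (N : ℕ) : AddCommGroup (SOp N) := inferInstanceAs (AddCommGroup (schwartzOpSubmodule N))

instance (N : ℕ) : Module ℂ (SOp N) := inferInstanceAs (Module ℂ (schwartzOpSubmodule N))

/-- The bounded operator underlying a Schwartz operator, linearly. -/
def SOp.toBounded {N : ℕ} : SOp N →ₗ[ℂ] (Hil N →L[ℂ] Hil N) := (schwartzOpSubmodule N).subtype

theorem SOp.isSchwartz {N : ℕ} (T : SOp N) : IsSchwartz T.toBounded := T.2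

/-- The seminorm `‖T‖_{α, α', β, β'}`, the supremum of `|⟨P^β Q^α ψ | T P^β' Q^α' φ⟩|` over
Schwartz functions `ψ, φ` of `L²`-norm at most one. -/
def opSeminorm {N : ℕ} (m : (Fin N → ℕ) × (Fin N → ℕ) × (Fin N → ℕ) × (Fin N → ℕ)) :
    Seminorm ℂ (SOp N) :=
  Seminorm.of (fun T => ⨆ x : UnitPair N, ‖form m T.toBounded x.1.1 x.1.2‖)
    (fun T S => ciSup_le fun x => by
      rw [map_add, form_add]
      exact (norm_add_le _ _).trans
        (add_le_add (le_ciSup (T.isSchwartz m) x) (le_ciSup (S.isSchwartz m) x)))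
    (fun c T => by
      simp only [map_smul, form_smul, norm_mul]
      exact (Real.mul_iSup_of_nonneg (norm_nonneg c) _).symm)

/-- The family of all seminorms `‖·‖_{α, α', β, β'}`. -/
def opSeminormFamily (N : ℕ) :
    SeminormFamily ℂ (SOp N) ((Fin N → ℕ) × (Fin N → ℕ) × (Fin N → ℕ) × (Fin N → ℕ)) :=
  fun m => opSeminorm m

/-- The locally convex topology of the space of Schwartz operators. -/
instance (N : ℕ) : TopologicalSpace (SOp N) := (opSeminormFamily N).moduleFilterBasis.topology

theorem withSeminorms_sOp (N : ℕ) : WithSeminorms (opSeminormFamily N) := ⟨rfl⟩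

/-- The tempered distributions on Schwartz operators: the continuous linear functionals. -/
abbrev TemperedDistr (N : ℕ) : Type := SOp N →L[ℂ] ℂ

/-! ### Products with polynomials, Hilbert-Schmidt operators, trace -/

/-- The bounded operator `S` extends `f_L(Q,P) T f_R(Q,P)`, which is defined on the Schwartz
functions: for each Schwartz function `φ`, the vector `T f_R(Q,P) φ` is a Schwartz function `χ`, and
`S φ = f_L(Q,P) χ`. -/
def IsSandwich {N : ℕ} (fL fR : FreeAlgebra ℂ (Fin N ⊕ Fin N)) (T S : Hil N →L[ℂ] Hil N) : Prop :=
  ∀ φ : SFun N, ∃ χ : SFun N, T (vec (polyOp fR φ)) = vec χ ∧ S (vec φ) = vec (polyOp fL χ)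

/-- `A` is a Hilbert-Schmidt operator: `tr |A|² = ∑ ‖A e_i‖²` is finite in an orthonormal basis. -/
def IsHilbertSchmidt {E : Type} [NormedAddCommGroup E] [InnerProductSpace ℂ E]
    (A : E →L[ℂ] E) : Prop :=
  ∃ (ι : Type) (e : HilbertBasis ι ℂ E), Summable fun i => ‖A (e i)‖ ^ 2

/-- `B` is a trace class operator: `tr |B| = ∑ ⟨e_i, |B| e_i⟩` is finite in an orthonormal basis,
where `|B|` is the square root of `B* B`. -/
def IsTraceClass {E : Type} [NormedAddCommGroup E] [InnerProductSpace ℂ E]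
    [CompleteSpace E] (B : E →L[ℂ] E) : Prop :=
  ∃ (ι : Type) (e : HilbertBasis ι ℂ E), Summable fun i => inner ℂ (e i) (CFC.abs B (e i))

/-- `B` is a trace class operator and `tr B = c`, the trace being `∑ ⟨e_i, B e_i⟩` in whichever
orthonormal basis. -/
def HasTrace {E : Type} [NormedAddCommGroup E] [InnerProductSpace ℂ E]
    [CompleteSpace E] (B : E →L[ℂ] E) (c : ℂ) : Prop :=
  IsTraceClass B ∧
    ∀ (ι : Type) (e : HilbertBasis ι ℂ E), HasSum (fun i => inner ℂ (e i) (B (e i))) c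

end SchwartzOperators

end

/-! Let `R = (1 + ∑ P_i²)⁻¹` and `W = (1 + |q|²)⁻¹` act on Schwartz functions, and put `Y = W^k
R^n`. Its inverse `X = (1 + ∑ P_i²)^n (1 + |q|²)^k` is a polynomial in `Q` and `P`. Two properties
carry the proof. First, `Y` absorbs polynomials: `Y M` is bounded in `L²` for every polynomial `M`,
once `n` and then `k` are large (`eventually_resolvent_mul_mem_boundedEnd`). Second, `W^m R^m` is
Hilbert-Schmidt for `m > N`, by a Sobolev inequality and the decay of `W^m`
(`exists_isHilbertSchmidt_resolvent`).

Normal ordering (`weylAlgebra_le_span`) lets the given seminorms control every form `⟨Mψ | T M'φ⟩`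
with polynomials `M`, `M'`. Hence `Tφ` lies in the domain of the adjoint of every polynomial, so it
is a Schwartz function (`exists_vec_eq`), and `P_L T P_R` extends boundedly
(`exists_isSandwich_norm_le`).

Part 1: inserting `Y X` on the left with `n = k = N + 1` gives `P_L T P_R = K S'`, where `K` is a
fixed Hilbert-Schmidt operator and `S'` is the bounded extension of `X P_L T P_R`
(`exists_sandwich_eq_comp`). So `A (P_L T P_R)` is a product of two Hilbert-Schmidt operators, and
its trace equals `tr (K S' A)`, which is at most a constant times `‖S'‖`, hence continuous in `T`.

Part 2: a continuous `Φ` is bounded by finitely many seminorms. Since `P^β Q^α = X (Y P^β Q^α)` with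
common `n` and `k`, these are bounded by the operator norm of `X* T X`
(`exists_opSeminorm_le_norm_sandwich`), hence by its Hilbert-Schmidt norm. Riesz representation on
the closed span of these operators in the Hilbert-Schmidt space yields `A`
(`exists_hasTrace_of_bounded`). -/

noncomputable section

namespace SchwartzOperators

/-! ### Hilbert-Schmidt operators and the trace -/

section HilbertSchmidt

open scoped ENNReal InnerProductSpace

variable {E : Type} [NormedAddCommGroup E] [InnerProductSpace ℂ E]

/-- Parseval with values in `ℝ≥0∞`, so that double sums can be interchanged before anything is known
to be finite. -/
theorem enorm_sq_eq_tsum {κ : Type} (f : HilbertBasis κ ℂ E) (x : E) :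
    ‖x‖ₑ ^ 2 = ∑' j, ‖inner ℂ (f j) x‖ₑ ^ 2 := by
  have h := (f.hasSum_inner_mul_inner x x)
  have h2 : HasSum (fun j => ‖inner ℂ (f j) x‖ ^ 2) (‖x‖ ^ 2) := by
    have := (RCLike.hasSum_re ℂ h)
    rw [inner_self_eq_norm_sq] at this
    convert! this using 2 with j
    rw [← inner_conj_symm x (f j), RCLike.conj_mul]
    norm_cast
  have h3 := ENNReal.ofReal_tsum_of_nonneg (fun j => sq_nonneg ‖inner ℂ (f j) x‖) h2.summable
  rw [h2.tsum_eq] at h3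
  simpa only [ENNReal.ofReal_pow (norm_nonneg _), ofReal_norm] using h3

theorem summable_norm_mul_norm {E F ι : Type} [NormedAddCommGroup E] [NormedAddCommGroup F]
    {u : ι → E} {v : ι → F} (hu : Summable fun i => ‖u i‖ ^ 2)
    (hv : Summable fun i => ‖v i‖ ^ 2) : Summable fun i => ‖u i‖ * ‖v i‖ :=
  (hu.add hv).of_nonneg_of_le (fun i => by positivity) fun i => by
    nlinarith [sq_nonneg (‖u i‖ - ‖v i‖), sq_nonneg ‖u i‖, sq_nonneg ‖v i‖]

theorem summable_norm_sq_iff {E ι : Type} [NormedAddCommGroup E] (g : ι → E) :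
    Summable (fun i => ‖g i‖ ^ 2) ↔ ∑' i, ‖g i‖ₑ ^ 2 ≠ ⊤ := by
  have h : ∀ i, ‖g i‖ₑ ^ 2 = ((‖g i‖₊ ^ 2 : NNReal) : ℝ≥0∞) := fun i => by
    rw [ENNReal.coe_pow]; rfl
  simp_rw [h]
  rw [ENNReal.tsum_coe_ne_top_iff_summable, ← NNReal.summable_coe]
  simp

theorem IsHilbertSchmidt.comp_left {A : E →L[ℂ] E} (hA : IsHilbertSchmidt A) (B : E →L[ℂ] E) :
    IsHilbertSchmidt (B ∘L A) := by
  obtain ⟨ι, e, h⟩ := hA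
  refine ⟨ι, e, (h.mul_left (‖B‖ ^ 2)).of_nonneg_of_le (fun i => sq_nonneg _) fun i => ?_⟩
  rw [← mul_pow]
  exact pow_le_pow_left₀ (norm_nonneg _) (B.le_opNorm _) 2

/-- Square summable images of a Hilbert basis define an operator. -/
theorem exists_apply_eq_of_summable {ι : Type} (e : HilbertBasis ι ℂ E) (a : ι → E)
    (ha : Summable fun i => ‖a i‖ ^ 2) :
    ∃ A : E →L[ℂ] E, ∀ i u, inner ℂ (e i) (A u) = inner ℂ (a i) u := by
  have hs : ∀ u, Summable fun i => ‖inner ℂ (a i) u‖ ^ 2 := fun u =>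
    (ha.mul_right (‖u‖ ^ 2)).of_nonneg_of_le (fun i => sq_nonneg _) fun i => by
      rw [← mul_pow]
      exact pow_le_pow_left₀ (norm_nonneg _) (norm_inner_le_norm _ _) 2
  have hm : ∀ u, Memℓp (fun i => inner ℂ (a i) u) 2 := fun u => by
    refine memℓp_gen ?_
    simpa using hs u
  -- The vectors `a i` play the role of `A* (e i)`, so `L u` is the coordinate sequence of `A u`.
  let L : E →ₗ[ℂ] lp (fun _ : ι => ℂ) 2 :=
    { toFun := fun u => ⟨fun i => inner ℂ (a i) u, hm u⟩
      map_add' := fun u v => by ext i; exact inner_add_right _ _ _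
      map_smul' := fun c u => by ext i; exact inner_smul_right _ _ _ }
  have hL : ∀ u, ‖L u‖ ≤ Real.sqrt (∑' i, ‖a i‖ ^ 2) * ‖u‖ := fun u => by
    rw [← abs_of_nonneg (norm_nonneg (L u)),
      ← abs_of_nonneg (mul_nonneg (Real.sqrt_nonneg _) (norm_nonneg u)), ← sq_le_sq, mul_pow,
      Real.sq_sqrt (tsum_nonneg fun i => sq_nonneg _), ← tsum_mul_right]
    have h := lp.norm_rpow_eq_tsum (p := 2) (by simp) (L u)
    simp only [ENNReal.toReal_ofNat, Real.rpow_ofNat] at h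
    rw [h]
    refine (hs u).tsum_le_tsum (fun i => ?_) (ha.mul_right _)
    rw [← mul_pow]
    exact pow_le_pow_left₀ (norm_nonneg _) (norm_inner_le_norm _ _) 2
  refine ⟨(e.repr.symm.toContinuousLinearEquiv : _ →L[ℂ] E) ∘L (L.mkContinuous _ hL),
    fun i u => ?_⟩
  rw [← HilbertBasis.repr_apply_apply]
  simp [L]

variable [CompleteSpace E]

/-- Both sides are iterated sums of `|⟨f j, A (e i)⟩|²`. Since `e` and `f` are unrelated, applying
this twice makes the Hilbert-Schmidt condition independent of the basis. -/
theorem tsum_enorm_sq_adjoint {ι κ : Type} (e : HilbertBasis ι ℂ E) (f : HilbertBasis κ ℂ E)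
    (A : E →L[ℂ] E) :
    ∑' i, ‖A (e i)‖ₑ ^ 2 = ∑' j, ‖ContinuousLinearMap.adjoint A (f j)‖ₑ ^ 2 := by
  simp_rw [enorm_sq_eq_tsum f (A _), enorm_sq_eq_tsum e (ContinuousLinearMap.adjoint A _)]
  rw [ENNReal.tsum_comm]
  refine tsum_congr fun j => tsum_congr fun i => ?_
  rw [ContinuousLinearMap.adjoint_inner_right, ← inner_conj_symm, RCLike.enorm_conj]

theorem IsHilbertSchmidt.summable {A : E →L[ℂ] E} (hA : IsHilbertSchmidt A) {κ : Type}
    (f : HilbertBasis κ ℂ E) : Summable fun j => ‖A (f j)‖ ^ 2 := by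
  obtain ⟨ι, e, h⟩ := hA
  rw [summable_norm_sq_iff] at h ⊢
  rwa [tsum_enorm_sq_adjoint f e, ← tsum_enorm_sq_adjoint e e]

theorem IsHilbertSchmidt.adjoint {A : E →L[ℂ] E} (hA : IsHilbertSchmidt A) :
    IsHilbertSchmidt (ContinuousLinearMap.adjoint A) := by
  obtain ⟨ι, e, h⟩ := hA
  refine ⟨ι, e, ?_⟩
  rw [summable_norm_sq_iff] at h ⊢
  rwa [← tsum_enorm_sq_adjoint e e]

theorem IsHilbertSchmidt.comp_right {A : E →L[ℂ] E} (hA : IsHilbertSchmidt A) (B : E →L[ℂ] E) :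
    IsHilbertSchmidt (A ∘L B) := by
  have h := (hA.adjoint.comp_left (ContinuousLinearMap.adjoint B)).adjoint
  rwa [← ContinuousLinearMap.adjoint_comp, ContinuousLinearMap.adjoint_adjoint] at h

theorem IsHilbertSchmidt.summable_prod {A : E →L[ℂ] E} (hA : IsHilbertSchmidt A) {ι κ : Type}
    (e : HilbertBasis ι ℂ E) (f : HilbertBasis κ ℂ E) :
    Summable fun p : ι × κ => ‖inner ℂ (f p.2) (A (e p.1))‖ ^ 2 := by
  rw [summable_norm_sq_iff, ENNReal.tsum_prod (f := fun i j => ‖inner ℂ (f j) (A (e i))‖ₑ ^ 2)]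
  simp_rw [← enorm_sq_eq_tsum f]
  exact (summable_norm_sq_iff _).1 (hA.summable e)

/-- The double series whose iterated sums are `tr (A S)` and `tr (S A)`. -/
theorem summable_inner_mul_inner_prod {A S : E →L[ℂ] E} (hA : IsHilbertSchmidt A)
    (hS : IsHilbertSchmidt S) {ι κ : Type} (e : HilbertBasis ι ℂ E) (f : HilbertBasis κ ℂ E) :
    Summable fun p : ι × κ => inner ℂ (e p.1) (A (f p.2)) * inner ℂ (f p.2) (S (e p.1)) := by
  have h1 : Summable fun p : ι × κ => ‖inner ℂ (e p.1) (A (f p.2))‖ ^ 2 :=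
    (hA.summable_prod f e).prod_symm
  refine Summable.of_norm ?_
  simpa only [norm_mul] using summable_norm_mul_norm h1 (hS.summable_prod e f)

/-- One absolutely convergent double series is summed along its two directions. With two different
bases this gives cyclicity and basis independence of the trace at once. -/
theorem hasSum_trace_comp {A S : E →L[ℂ] E} (hA : IsHilbertSchmidt A) (hS : IsHilbertSchmidt S)
    {ι κ : Type} (e : HilbertBasis ι ℂ E) (f : HilbertBasis κ ℂ E) :
    HasSum (fun i => inner ℂ (e i) ((A ∘L S) (e i))) (∑' j, inner ℂ (f j) ((S ∘L A) (f j))) := by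
  have h := summable_inner_mul_inner_prod hA hS e f
  have h1 : HasSum (fun i => inner ℂ (e i) ((A ∘L S) (e i))) _ :=
    h.hasSum.prod_fiberwise fun i => by
      have := f.hasSum_inner_mul_inner (ContinuousLinearMap.adjoint A (e i)) (S (e i))
      rw [ContinuousLinearMap.adjoint_inner_left] at this
      exact this.congr_fun fun j => by rw [ContinuousLinearMap.adjoint_inner_left]
  have h2 : HasSum (fun j => inner ℂ (f j) ((S ∘L A) (f j))) _ :=
    ((Equiv.prodComm κ ι).hasSum_iff.2 h.hasSum).prod_fiberwise fun j => by
      have := e.hasSum_inner_mul_inner (ContinuousLinearMap.adjoint S (f j)) (A (f j))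
      rw [ContinuousLinearMap.adjoint_inner_left] at this
      exact this.congr_fun fun i => by
        rw [ContinuousLinearMap.adjoint_inner_left, mul_comm]; rfl
  rwa [h2.tsum_eq]

theorem norm_abs_apply (B : E →L[ℂ] E) (x : E) : ‖CFC.abs B x‖ = ‖B x‖ := by
  have h0 : ContinuousLinearMap.adjoint (CFC.abs B) = CFC.abs B :=
    (IsSelfAdjoint.of_nonneg (CFC.abs_nonneg B)).star_eq
  have h : inner ℂ (CFC.abs B x) (CFC.abs B x) = inner ℂ (B x) (B x) := by
    rw [← ContinuousLinearMap.adjoint_inner_right, h0]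
    have := congrArg (fun C : E →L[ℂ] E => inner ℂ x (C x)) (CFC.abs_mul_abs B)
    simpa only [mul_apply_eq_comp, ContinuousLinearMap.star_eq_adjoint,
      ContinuousLinearMap.adjoint_inner_right] using this
  rw [inner_self_eq_norm_sq_to_K, inner_self_eq_norm_sq_to_K] at h
  have h' : ‖CFC.abs B x‖ ^ 2 = ‖B x‖ ^ 2 := by exact_mod_cast h
  exact (pow_left_inj₀ (norm_nonneg _) (norm_nonneg _) two_ne_zero).1 h'

/-- The part of the polar decomposition that is needed: `|B|` factors through `B`. -/
theorem exists_comp_eq_abs (B : E →L[ℂ] E) : ∃ V : E →L[ℂ] E, V ∘L B = CFC.abs B := by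
  let K : Submodule ℂ E := B.range.topologicalClosure
  have : CompleteSpace K := (Submodule.isClosed_topologicalClosure _).completeSpace_coe
  let b : E →ₗ[ℂ] K :=
    (B : E →ₗ[ℂ] E).codRestrict K fun x => Submodule.le_topologicalClosure _ ⟨x, rfl⟩
  have hd : DenseRange b := by
    rw [DenseRange, Subtype.dense_iff]
    intro x hx
    refine closure_mono ?_ hx
    rintro _ ⟨y, rfl⟩
    exact ⟨b y, ⟨y, rfl⟩, rfl⟩
  -- Since `‖|B| x‖ = ‖B x‖`, the assignment `B x ↦ |B| x` is well defined and extends to the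
  -- closure of the range of `B`.
  have hn : ∀ x, ‖((CFC.abs B : E →L[ℂ] E) : E →ₗ[ℂ] E) x‖ ≤ 1 * ‖b x‖ := fun x => by
    rw [one_mul]; exact (norm_abs_apply B x).le
  refine ⟨(((CFC.abs B : E →L[ℂ] E) : E →ₗ[ℂ] E).extendOfNorm b) ∘L K.orthogonalProjectionOnto, ?_⟩
  ext x
  have h1 : K.orthogonalProjectionOnto (B x) = b x :=
    Submodule.orthogonalProjectionOnto_mem_subspace_eq_self (b x)
  rw [ContinuousLinearMap.comp_apply, ContinuousLinearMap.comp_apply, h1,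
    LinearMap.extendOfNorm_eq hd ⟨1, hn⟩]
  rfl

/-- By the polar decomposition `|A S| = (V A) S`, which is again a product of two Hilbert-Schmidt
operators, so its diagonal is summable. -/
theorem IsHilbertSchmidt.isTraceClass_comp {A S : E →L[ℂ] E} (hA : IsHilbertSchmidt A)
    (hS : IsHilbertSchmidt S) : IsTraceClass (A ∘L S) := by
  obtain ⟨V, hV⟩ := exists_comp_eq_abs (A ∘L S)
  obtain ⟨ι, e, -⟩ := id hA
  refine ⟨ι, e, ?_⟩
  rw [← hV, ← ContinuousLinearMap.comp_assoc]
  exact (hasSum_trace_comp (hA.comp_left V) hS e e).summable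

theorem IsHilbertSchmidt.hasTrace_comp {A S : E →L[ℂ] E} (hA : IsHilbertSchmidt A)
    (hS : IsHilbertSchmidt S) {ι : Type} (e : HilbertBasis ι ℂ E) {c : ℂ}
    (hc : HasSum (fun i => inner ℂ (e i) ((A ∘L S) (e i))) c) : HasTrace (A ∘L S) c := by
  refine ⟨hA.isTraceClass_comp hS, fun κ f => ?_⟩
  rw [hc.unique (hasSum_trace_comp hA hS e e)]
  exact hasSum_trace_comp hA hS f e

/-- Passing to `A*` makes this Parseval: the coefficients of `A* w` are `⟨A (e i), w⟩`, to which
Cauchy-Schwarz applies termwise. -/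
theorem norm_sq_le_tsum {ι : Type} (e : HilbertBasis ι ℂ E) (A : E →L[ℂ] E)
    (hA : Summable fun i => ‖A (e i)‖ ^ 2) : ‖A‖ ^ 2 ≤ ∑' i, ‖A (e i)‖ ^ 2 := by
  have h0 : 0 ≤ ∑' i, ‖A (e i)‖ ^ 2 := tsum_nonneg fun i => sq_nonneg _
  refine (Real.le_sqrt (norm_nonneg _) h0).1 ?_
  rw [← ContinuousLinearMap.adjoint.norm_map A]
  refine ContinuousLinearMap.opNorm_le_bound _ (Real.sqrt_nonneg _) fun w => ?_
  rw [← abs_of_nonneg (norm_nonneg (ContinuousLinearMap.adjoint A w)),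
    ← abs_of_nonneg (mul_nonneg (Real.sqrt_nonneg _) (norm_nonneg w)), ← sq_le_sq, mul_pow,
    Real.sq_sqrt h0]
  have h1 := e.hasSum_inner_mul_inner (ContinuousLinearMap.adjoint A w)
    (ContinuousLinearMap.adjoint A w)
  have h2 := RCLike.hasSum_re ℂ h1
  rw [inner_self_eq_norm_sq] at h2
  refine hasSum_le (fun i => ?_) h2 (hA.hasSum.mul_right (‖w‖ ^ 2))
  rw [← inner_conj_symm, RCLike.conj_mul, ContinuousLinearMap.adjoint_inner_right]
  norm_cast
  rw [← mul_pow]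
  exact pow_le_pow_left₀ (norm_nonneg _) (norm_inner_le_norm _ _) 2

/-- A functional that is bounded by the Hilbert-Schmidt norm of `S v` is `v ↦ tr (A S v)` with a
Hilbert-Schmidt operator `A`. -/
theorem exists_hasTrace_of_bounded {V : Type} [AddCommGroup V] [Module ℂ V]
    (S : V →ₗ[ℂ] (E →L[ℂ] E)) (hS : ∀ v, IsHilbertSchmidt (S v)) (Φ : V →ₗ[ℂ] ℂ) (C : ℝ)
    (hΦ : ∀ v, ‖Φ v‖ ≤ C * ‖S v‖) :
    ∃ A : E →L[ℂ] E, IsHilbertSchmidt A ∧ ∀ v, HasTrace (A ∘L S v) (Φ v) := by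
  obtain ⟨w, e, -⟩ := exists_hilbertBasis ℂ E
  have hm : ∀ v, Memℓp (fun i => S v (e i)) 2 := fun v => by
    refine memℓp_gen ?_
    simpa using (hS v).summable e
  let J : V →ₗ[ℂ] lp (fun _ : w => E) 2 :=
    { toFun := fun v => ⟨fun i => S v (e i), hm v⟩
      map_add' := fun u v => by ext i; exact congrArg (fun B : E →L[ℂ] E => B (e i)) (S.map_add u v)
      map_smul' := fun c u => by ext i; simp }
  -- `J` realises the operators `S v` as square summable families, with the Hilbert-Schmidt norm.
  -- Hence `Φ` factors through a bounded functional on the closure of the range of `J`.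
  have hJ : ∀ v, ‖S v‖ ≤ ‖J v‖ := fun v => by
    rw [← abs_of_nonneg (norm_nonneg (S v)), ← abs_of_nonneg (norm_nonneg (J v)), ← sq_le_sq]
    have h := lp.norm_rpow_eq_tsum (p := 2) (by simp) (J v)
    simp only [ENNReal.toReal_ofNat, Real.rpow_ofNat] at h
    rw [h]
    exact norm_sq_le_tsum e (S v) ((hS v).summable e)
  let K := J.range.topologicalClosure
  have : CompleteSpace K := (Submodule.isClosed_topologicalClosure _).completeSpace_coe
  let b : V →ₗ[ℂ] K := J.codRestrict K fun x => Submodule.le_topologicalClosure _ ⟨x, rfl⟩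
  have hd : DenseRange b := by
    rw [DenseRange, Subtype.dense_iff]
    intro x hx
    refine closure_mono ?_ hx
    rintro _ ⟨y, rfl⟩
    exact ⟨b y, ⟨y, rfl⟩, rfl⟩
  have hn : ∀ v, ‖Φ v‖ ≤ |C| * ‖b v‖ := fun v =>
    (hΦ v).trans (mul_le_mul (le_abs_self C) (hJ v) (norm_nonneg _) (abs_nonneg C))
  let a := (InnerProductSpace.toDual ℂ K).symm (Φ.extendOfNorm b)
  have ha : ∀ v, inner ℂ (a : lp (fun _ : w => E) 2) (J v) = Φ v := fun v => by
    have h : inner ℂ a (b v) = Φ v := by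
      rw [InnerProductSpace.toDual_symm_apply, LinearMap.extendOfNorm_eq hd ⟨_, hn⟩]
    exact h
  have hs : Summable fun i => ‖(a : lp (fun _ : w => E) 2) i‖ ^ 2 := by
    have h := lp.memℓp (a : lp (fun _ : w => E) 2)
    rw [memℓp_gen_iff (by simp)] at h
    simpa using h
  -- The Riesz vector `a` becomes the operator with `A* (e i) = a i`, so that `tr (A S v) = ∑ ⟨a i,
  -- S v (e i)⟩ = ⟨a, J v⟩ = Φ v`.
  obtain ⟨A, hA⟩ := exists_apply_eq_of_summable e _ hs
  have hA' : IsHilbertSchmidt A := by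
    rw [← ContinuousLinearMap.adjoint_adjoint A]
    refine IsHilbertSchmidt.adjoint ⟨w, e, hs.congr fun i => ?_⟩
    congr 2
    refine ext_inner_right ℂ fun u => ?_
    rw [ContinuousLinearMap.adjoint_inner_left, hA]
  refine ⟨A, hA', fun v => hA'.hasTrace_comp (hS v) e ?_⟩
  rw [← ha v]
  exact (lp.hasSum_inner _ (J v)).congr_fun fun i => hA i _

end HilbertSchmidt

/-! ### Completeness of the Schwartz space -/

section Complete

open Filter Topology
open scoped ContDiff

variable {E F : Type*} [NormedAddCommGroup E] [NormedSpace ℝ E] [NormedAddCommGroup F]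
  [NormedSpace ℝ F]

theorem eventually_norm_iteratedFDeriv_sub_le {l : Filter 𝓢(E, F)} (hl : Cauchy l) (k n : ℕ)
    {ε : ℝ} (hε : 0 < ε) : ∀ᶠ p in l ×ˢ l, ∀ x,
      ‖x‖ ^ k * ‖iteratedFDeriv ℝ n p.2 x - iteratedFDeriv ℝ n p.1 x‖ ≤ ε := by
  have h := hl.2
  rw [uniformity_eq_comap_nhds_zero, ← tendsto_iff_comap,
    (schwartz_withSeminorms ℝ E F).tendsto_nhds] at h
  filter_upwards [h (k, n) ε hε] with p hp x
  have h1 := SchwartzMap.le_seminorm ℝ k n (p.2 - p.1) x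
  have h2 : iteratedFDeriv ℝ n (p.2 - p.1 : 𝓢(E, F)) x =
      iteratedFDeriv ℝ n p.2 x - iteratedFDeriv ℝ n p.1 x :=
    iteratedFDeriv_sub_apply (p.2.contDiffAt n) (p.1.contDiffAt n)
  rw [h2] at h1
  rw [sub_zero] at hp
  exact h1.trans hp.le

/-- All derivatives converge uniformly, even with polynomial weights, and differentiation passes to
uniform limits. `exists_vec_eq` uses this to obtain a Schwartz function as the limit of a Cauchy
filter. -/
instance completeSpace_schwartzMap [CompleteSpace F] : CompleteSpace 𝓢(E, F) := by
  refine ⟨fun {l} hl => ?_⟩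
  have := hl.1
  have hpt : ∀ n x, ∃ y, Tendsto (fun φ : 𝓢(E, F) => iteratedFDeriv ℝ n φ x) l (𝓝 y) := by
    intro n x
    refine CompleteSpace.complete (f := map _ l) ?_
    refine ⟨inferInstance, ?_⟩
    rw [prod_map_map_eq, ← Tendsto, Metric.uniformity_basis_dist_le.tendsto_right_iff]
    intro ε hε
    filter_upwards [eventually_norm_iteratedFDeriv_sub_le hl 0 n hε] with p hp
    have := hp x
    rwa [pow_zero, one_mul, ← dist_eq_norm, dist_comm] at this
  choose G hG using hpt
  have hunif : ∀ k n, ∀ ε > 0, ∀ᶠ φ : 𝓢(E, F) in l, ∀ x,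
      ‖x‖ ^ k * ‖G n x - iteratedFDeriv ℝ n φ x‖ ≤ ε := by
    intro k n ε hε
    -- One member `φ` of the Cauchy pair is kept fixed while the other runs to the limit.
    filter_upwards [(eventually_norm_iteratedFDeriv_sub_le hl k n hε).curry] with φ hφ x
    refine le_of_tendsto (((hG n x).sub_const _).norm.const_mul _) ?_
    filter_upwards [hφ] with ψ hψ using hψ x
  have htu : ∀ n, TendstoUniformly (fun φ : 𝓢(E, F) => iteratedFDeriv ℝ n φ) (G n) l := by
    intro n
    rw [Metric.tendstoUniformly_iff]
    intro ε hε
    filter_upwards [hunif 0 n (ε / 2) (half_pos hε)] with φ hφ x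
    have := hφ x
    rw [pow_zero, one_mul, ← dist_eq_norm] at this
    exact this.trans_lt (half_lt_self hε)
  let g : E → F := fun x => (G 0 x).curry0
  have hT : HasFTaylorSeriesUpTo ∞ g fun x n => G n x := by
    refine ⟨fun x => rfl, fun n hn x => ?_, fun n hn => ?_⟩
    · refine hasFDerivAt_of_tendstoUniformly (l := l)
        (f := fun φ : 𝓢(E, F) => iteratedFDeriv ℝ n φ)
        (f' := fun φ x => (iteratedFDeriv ℝ (n + 1) φ x).curryLeft)
        (g' := fun x => (G (n + 1) x).curryLeft) ?_ ?_ (fun x => hG n x) x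
      · rw [Metric.tendstoUniformly_iff]
        intro ε hε
        filter_upwards [Metric.tendstoUniformly_iff.1 (htu (n + 1)) ε hε] with φ hφ x
        have h := hφ x
        rw [← (continuousMultilinearCurryLeftEquiv ℝ (fun _ : Fin (n + 1) => E) F).dist_map] at h
        exact h
      · intro φ x
        exact (contDiff_iff_ftaylorSeries.1 (φ.smooth ⊤)).fderiv n
          (by exact_mod_cast WithTop.coe_lt_top n) x
    · exact (htu n).continuous (Frequently.of_forall fun φ =>
        (φ.smooth ⊤).continuous_iteratedFDeriv (by exact_mod_cast le_top))
  have hit : ∀ n, iteratedFDeriv ℝ n g = G n := fun n => by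
    ext1 x
    exact (hT.eq_iteratedFDeriv (by exact_mod_cast le_top) x).symm
  let χ : 𝓢(E, F) :=
    { toFun := g
      smooth' := hT.contDiff
      decay' := fun k n => by
        obtain ⟨φ, hφ⟩ := (hunif k n 1 one_pos).exists
        obtain ⟨C, hC⟩ := φ.decay' k n
        refine ⟨1 + C, fun x => ?_⟩
        rw [hit, ← sub_add_cancel (G n x) (iteratedFDeriv ℝ n φ x)]
        refine (mul_le_mul_of_nonneg_left (norm_add_le _ _) (by positivity)).trans ?_
        rw [mul_add]
        exact add_le_add (hφ x) (hC x) }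
  refine ⟨χ, ?_⟩
  rw [← tendsto_id', (schwartz_withSeminorms ℝ E F).tendsto_nhds]
  rintro ⟨k, n⟩ ε hε
  filter_upwards [hunif k n (ε / 2) (half_pos hε)] with φ hφ
  refine lt_of_le_of_lt ?_ (half_lt_self hε)
  refine SchwartzMap.seminorm_le_bound ℝ k n _ (half_pos hε).le fun x => ?_
  have h2 : iteratedFDeriv ℝ n (id φ - χ : 𝓢(E, F)) x =
      iteratedFDeriv ℝ n φ x - iteratedFDeriv ℝ n χ x :=
    iteratedFDeriv_sub_apply (φ.contDiffAt n) (χ.contDiffAt n)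
  rw [h2, norm_sub_rev]
  have h3 : iteratedFDeriv ℝ n χ x = G n x := congrFun (hit n) x
  rw [h3]
  exact hφ x

end Complete

/-! ### Operators on Schwartz functions, bounded and symmetric in `L²` -/

section Operators

open FourierTransform Real
open scoped ComplexConjugate

variable {N : ℕ}

/-- The continuous linear operators on Schwartz functions. -/
abbrev SchwartzEnd (N : ℕ) : Type := SFun N →L[ℂ] SFun N

/-- The embedding of Schwartz functions in `L²`, linearly. -/
abbrev vecL (N : ℕ) : SFun N →L[ℂ] Hil N := SchwartzMap.toLpCLM ℂ ℂ 2 volume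

theorem vec_add (φ ψ : SFun N) : vec (φ + ψ) = vec φ + vec ψ := map_add (vecL N) φ ψ

theorem vec_sub (φ ψ : SFun N) : vec (φ - ψ) = vec φ - vec ψ := map_sub (vecL N) φ ψ

theorem vec_smul (c : ℂ) (φ : SFun N) : vec (c • φ) = c • vec φ := map_smul (vecL N) c φ

theorem vec_zero : vec (0 : SFun N) = 0 := map_zero (vecL N)

theorem vec_injective : Function.Injective (vec : SFun N → Hil N) :=
  SchwartzMap.injective_toLp 2 volume

theorem denseRange_vec : DenseRange (vecL N : SFun N →ₗ[ℂ] Hil N) :=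
  SchwartzMap.denseRange_toLpCLM (by simp)

/-- By density the hypothesis extends to all test vectors in `L²`, in particular to `u` itself. -/
theorem norm_le_of_inner_vec {u : Hil N} {C : ℝ} (hC : 0 ≤ C)
    (h : ∀ ψ : SFun N, ‖inner ℂ (vec ψ) u‖ ≤ C * ‖vec ψ‖) : ‖u‖ ≤ C := by
  have h1 : ‖inner ℂ u u‖ ≤ C * ‖u‖ :=
    denseRange_vec.induction_on (p := fun v : Hil N => ‖inner ℂ v u‖ ≤ C * ‖v‖) u
      (isClosed_le (by fun_prop) (by fun_prop)) h
  rw [inner_self_eq_norm_sq_to_K] at h1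
  norm_cast at h1
  rw [abs_of_nonneg (by positivity), sq] at h1
  rcases (norm_nonneg u).eq_or_lt with h0 | h0
  · rw [← h0]; exact hC
  · exact le_of_mul_le_mul_right h1 h0

theorem eq_of_inner_vec {u v : Hil N}
    (h : ∀ ψ : SFun N, inner ℂ (vec ψ) u = inner ℂ (vec ψ) v) : u = v := by
  rw [← sub_eq_zero, ← norm_le_zero_iff]
  refine norm_le_of_inner_vec le_rfl fun ψ => ?_
  rw [inner_sub_right, h ψ]
  simp

/-- The operators on Schwartz functions that are bounded in the norm of `L²`. -/
def boundedEnd (N : ℕ) : Subalgebra ℂ (SchwartzEnd N) where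
  carrier := {B | ∃ C, 0 ≤ C ∧ ∀ φ, ‖vec (B φ)‖ ≤ C * ‖vec φ‖}
  mul_mem' := by
    rintro A B ⟨a, ha, hA⟩ ⟨b, hb, hB⟩
    refine ⟨a * b, by positivity, fun φ => (hA _).trans ?_⟩
    rw [mul_assoc]
    exact mul_le_mul_of_nonneg_left (hB φ) ha
  add_mem' := by
    rintro A B ⟨a, ha, hA⟩ ⟨b, hb, hB⟩
    refine ⟨a + b, by positivity, fun φ => ?_⟩
    rw [add_apply, vec_add, add_mul]
    exact (norm_add_le _ _).trans (add_le_add (hA φ) (hB φ))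
  algebraMap_mem' c := by
    refine ⟨‖c‖, norm_nonneg c, fun φ => ?_⟩
    rw [Algebra.algebraMap_eq_smul_one, smul_apply, vec_smul, norm_smul]
    rfl

/-- `B` is a formal adjoint of `A` on Schwartz functions. -/
def IsFormalAdjoint (A B : SchwartzEnd N) : Prop :=
  ∀ ψ φ, inner ℂ (vec (A ψ)) (vec φ) = inner ℂ (vec ψ) (vec (B φ))

theorem IsFormalAdjoint.mul {A A' B B' : SchwartzEnd N} (hA : IsFormalAdjoint A A')
    (hB : IsFormalAdjoint B B') : IsFormalAdjoint (A * B) (B' * A') := fun ψ φ =>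
  (hA (B ψ) φ).trans (hB ψ (A' φ))

theorem IsFormalAdjoint.one : IsFormalAdjoint (1 : SchwartzEnd N) 1 := fun _ _ => rfl

theorem IsFormalAdjoint.pow {A A' : SchwartzEnd N} (hA : IsFormalAdjoint A A') (n : ℕ) :
    IsFormalAdjoint (A ^ n) (A' ^ n) := by
  induction n with
  | zero => exact .one
  | succ n ih => rw [pow_succ, pow_succ']; exact ih.mul hA

theorem IsFormalAdjoint.add {A A' B B' : SchwartzEnd N} (hA : IsFormalAdjoint A A')
    (hB : IsFormalAdjoint B B') : IsFormalAdjoint (A + B) (A' + B') := fun ψ φ => by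
  rw [add_apply, add_apply, vec_add, vec_add, inner_add_left, inner_add_right, hA, hB]

theorem IsFormalAdjoint.smul {A A' : SchwartzEnd N} (hA : IsFormalAdjoint A A') (c : ℂ) :
    IsFormalAdjoint (c • A) (conj c • A') := fun ψ φ => by
  rw [smul_apply, smul_apply, vec_smul, vec_smul, inner_smul_left, inner_smul_right, hA]

theorem IsFormalAdjoint.symm {A A' : SchwartzEnd N} (hA : IsFormalAdjoint A A') :
    IsFormalAdjoint A' A := fun ψ φ => by
  rw [← inner_conj_symm, ← hA, inner_conj_symm]

theorem inner_vec (ψ φ : SFun N) : inner ℂ (vec ψ) (vec φ) = ∫ x, inner ℂ (ψ x) (φ x) :=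
  SchwartzMap.inner_toL2_toL2_eq ψ φ volume

/-! #### Multiplication operators -/

theorem norm_vec_smulLeftCLM_le {g : Conf N → ℂ} (hg : g.HasTemperateGrowth) {C : ℝ}
    (hC : ∀ x, ‖g x‖ ≤ C) (φ : SFun N) :
    ‖vec (SchwartzMap.smulLeftCLM ℂ g φ)‖ ≤ C * ‖vec φ‖ := by
  refine Lp.norm_le_mul_norm_of_ae_le_mul ?_
  filter_upwards [SchwartzMap.coeFn_toLp φ 2 volume,
    SchwartzMap.coeFn_toLp (SchwartzMap.smulLeftCLM ℂ g φ) 2 volume] with x h1 h2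
  rw [h1, h2, SchwartzMap.smulLeftCLM_apply_apply hg, norm_smul]
  exact mul_le_mul_of_nonneg_right (hC x) (norm_nonneg _)

theorem hasTemperateGrowth_coord (i : Fin N) :
    (fun q : Conf N => ((q i : ℝ) : ℂ)).HasTemperateGrowth :=
  (Complex.ofRealCLM ∘L (EuclideanSpace.proj i : Conf N →L[ℝ] ℝ)).hasTemperateGrowth

theorem isFormalAdjoint_posOp (i : Fin N) : IsFormalAdjoint (posOp i) (posOp i) := fun ψ φ => by
  rw [inner_vec, inner_vec]
  refine integral_congr_ae (Filter.Eventually.of_forall fun x => ?_)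
  simp only [posOp_apply, RCLike.inner_apply, map_mul, Complex.conj_ofReal]
  ring

/-- The function `(1 + c² |q|²)⁻¹`. -/
def resolvent (N : ℕ) (c : ℝ) (q : Conf N) : ℝ := (1 + (c * ‖q‖) ^ 2)⁻¹

theorem hasTemperateGrowth_resolvent (c : ℝ) :
    (fun q : Conf N => (resolvent N c q : ℂ)).HasTemperateGrowth := by
  have h := (Function.hasTemperateGrowth_one_add_norm_sq_rpow (Conf N) (-1)).comp
    (c • ContinuousLinearMap.id ℝ (Conf N)).hasTemperateGrowth
  have h2 : (resolvent N c).HasTemperateGrowth := by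
    have h1 : resolvent N c = (fun q : Conf N => (1 + ‖q‖ ^ 2) ^ (-1 : ℝ)) ∘
        (c • ContinuousLinearMap.id ℝ (Conf N)) := funext fun q => by
      simp [resolvent, Real.rpow_neg_one, norm_smul, mul_pow]
    rw [h1]
    exact h
  exact Function.Complex.hasTemperateGrowth_ofReal.comp h2

/-- Multiplication by `(1 + c² |q|²)⁻¹`. -/
def invOp (N : ℕ) (c : ℝ) : SchwartzEnd N :=
  SchwartzMap.smulLeftCLM ℂ fun q : Conf N => (resolvent N c q : ℂ)

theorem invOp_apply (c : ℝ) (φ : SFun N) (q : Conf N) :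
    invOp N c φ q = (resolvent N c q : ℂ) * φ q := by
  rw [invOp, SchwartzMap.smulLeftCLM_apply_apply (hasTemperateGrowth_resolvent c), smul_eq_mul]

/-- The operator `1 + ∑ (c Q_i)²`. -/
def posSq (N : ℕ) (c : ℝ) : SchwartzEnd N := 1 + ∑ i, ((c : ℂ) • posOp i) ^ 2

theorem posSq_apply (c : ℝ) (φ : SFun N) (q : Conf N) :
    posSq N c φ q = ((1 + (c * ‖q‖) ^ 2 : ℝ) : ℂ) * φ q := by
  simp only [posSq, add_apply, sum_apply, one_apply_eq_self, pow_two, mul_apply_eq_comp,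
    smul_apply, posOp_apply, smul_eq_mul]
  have h : (c * ‖q‖) * (c * ‖q‖) = ∑ i, c ^ 2 * q i ^ 2 := by
    rw [← Finset.mul_sum, ← EuclideanSpace.real_norm_sq_eq]; ring
  rw [h]
  push_cast
  rw [add_mul, one_mul, Finset.sum_mul]
  congr 1
  refine Finset.sum_congr rfl fun i _ => ?_
  ring

theorem resolvent_mul (c : ℝ) (q : Conf N) : resolvent N c q * (1 + (c * ‖q‖) ^ 2) = 1 :=
  inv_mul_cancel₀ (by positivity)

theorem invOp_mul_posSq (c : ℝ) : invOp N c * posSq N c = 1 := by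
  ext φ q
  rw [mul_apply_eq_comp, invOp_apply, posSq_apply, ← mul_assoc, ← Complex.ofReal_mul,
    resolvent_mul, Complex.ofReal_one, one_mul]
  rfl

theorem posSq_mul_invOp (c : ℝ) : posSq N c * invOp N c = 1 := by
  ext φ q
  rw [mul_apply_eq_comp, posSq_apply, invOp_apply, ← mul_assoc, ← Complex.ofReal_mul, mul_comm,
    mul_comm (1 + _), resolvent_mul, Complex.ofReal_one, mul_one]
  rfl

theorem invOp_mem_boundedEnd (c : ℝ) : invOp N c ∈ boundedEnd N := by
  refine ⟨1, zero_le_one, norm_vec_smulLeftCLM_le (hasTemperateGrowth_resolvent c) fun q => ?_⟩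
  rw [Complex.norm_real, Real.norm_of_nonneg (by unfold resolvent; positivity)]
  exact inv_le_one_of_one_le₀ (by nlinarith [sq_nonneg (c * ‖q‖)])

theorem posOp_mul_invOp_mem_boundedEnd (c : ℝ) (i : Fin N) :
    ((c : ℂ) • posOp i) * invOp N c ∈ boundedEnd N := by
  let g : Conf N → ℂ := fun q => (c : ℂ) * ((q i : ℝ) : ℂ) * (resolvent N c q : ℂ)
  have hg : g.HasTemperateGrowth := ((Function.HasTemperateGrowth.const (c : ℂ)).mul
    (hasTemperateGrowth_coord i)).mul (hasTemperateGrowth_resolvent c)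
  have h : ((c : ℂ) • posOp i) * invOp N c = SchwartzMap.smulLeftCLM ℂ g := by
    ext φ q
    rw [SchwartzMap.smulLeftCLM_apply_apply hg, mul_apply_eq_comp, smul_apply, smul_apply,
      posOp_apply, invOp_apply]
    simp only [smul_eq_mul, g]
    ring
  rw [h]
  refine ⟨1, zero_le_one, norm_vec_smulLeftCLM_le hg fun q => ?_⟩
  simp only [g]
  rw [← Complex.ofReal_mul, ← Complex.ofReal_mul, Complex.norm_real, resolvent,
    ← div_eq_mul_inv, norm_div, Real.norm_of_nonneg (show 0 ≤ 1 + (c * ‖q‖) ^ 2 by positivity)]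
  refine div_le_one_of_le₀ ?_ (by positivity)
  have h1 : ‖q i‖ ≤ ‖q‖ := PiLp.norm_apply_le q i
  have h2 : ‖c * q i‖ ≤ |c * ‖q‖| := by
    rw [norm_mul, abs_mul, abs_of_nonneg (norm_nonneg q), Real.norm_eq_abs c]
    exact mul_le_mul_of_nonneg_left h1 (abs_nonneg c)
  nlinarith [sq_nonneg (|c * ‖q‖| - 1), sq_abs (c * ‖q‖)]

/-! #### Conjugation with the Fourier transform -/

/-- Conjugation with the Fourier transform. -/
def fourierConj (N : ℕ) : SchwartzEnd N →ₐ[ℂ] SchwartzEnd N where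
  toFun B := fourierInvCLM ℂ (SFun N) ∘L B ∘L fourierCLM ℂ (SFun N)
  map_one' := by ext1 φ; simp
  map_mul' A B := by ext1 φ; simp
  map_zero' := by ext1 φ; simp
  map_add' A B := by ext1 φ; simp
  commutes' c := by ext1 φ; simp [Algebra.algebraMap_eq_smul_one]

theorem fourierConj_apply (B : SchwartzEnd N) (φ : SFun N) :
    fourierConj N B φ = 𝓕⁻ (B (𝓕 φ)) := rfl

theorem norm_vec_fourier (φ : SFun N) : ‖vec (𝓕 φ)‖ = ‖vec φ‖ :=
  SchwartzMap.norm_fourier_toL2_eq φ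

theorem norm_vec_fourierInv (φ : SFun N) : ‖vec (𝓕⁻ φ)‖ = ‖vec φ‖ := by
  rw [← norm_vec_fourier, FourierTransform.fourier_fourierInv_eq]

theorem fourierConj_mem_boundedEnd {B : SchwartzEnd N} (hB : B ∈ boundedEnd N) :
    fourierConj N B ∈ boundedEnd N := by
  obtain ⟨C, hC, h⟩ := hB
  refine ⟨C, hC, fun φ => ?_⟩
  rw [fourierConj_apply, norm_vec_fourierInv, ← norm_vec_fourier φ]
  exact h _

theorem IsFormalAdjoint.fourierConj {A A' : SchwartzEnd N} (h : IsFormalAdjoint A A') :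
    IsFormalAdjoint (fourierConj N A) (fourierConj N A') := fun ψ φ => by
  rw [fourierConj_apply, fourierConj_apply, ← SchwartzMap.inner_fourier_toL2_eq,
    FourierTransform.fourier_fourierInv_eq, h, ← SchwartzMap.inner_fourier_toL2_eq ψ,
    FourierTransform.fourier_fourierInv_eq]

/-- The Fourier transform with kernel `e^{-2πi⟨x,ξ⟩}` turns `∂_i` into multiplication by `2πi ξ_i`.
This is why the position operators above carry a scale `c`: `c = 1` serves position and `c = 2π` is
transported to momentum. -/
theorem momOp_eq (i : Fin N) :
    momOp i = fourierConj N (((2 * π : ℝ) : ℂ) • posOp i) := by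
  ext1 φ
  have h := SchwartzMap.lineDeriv_eq_fourierMultiplierCLM (EuclideanSpace.single i (1 : ℝ)) φ
  have h2 : (fun x : Conf N => ((inner ℝ x (EuclideanSpace.single i (1 : ℝ)) : ℝ) : ℂ)) =
      fun x => ((x i : ℝ) : ℂ) := by
    ext x
    simp [EuclideanSpace.inner_single_right]
  rw [← SchwartzMap.fourierMultiplierCLM_ofReal ℂ (by fun_prop)] at h
  have h3 : momOp i φ = (-Complex.I) •
      LineDeriv.lineDerivOp (EuclideanSpace.single i (1 : ℝ) : Conf N) φ := rfl
  rw [h3, h, map_smul, smul_apply, smul_smul]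
  have h4 : -Complex.I * (2 * π * Complex.I) = ((2 * π : ℝ) : ℂ) := by
    push_cast
    linear_combination (-(2 * (π : ℂ))) * Complex.I_mul_I
  rw [h4, fourierConj_apply, SchwartzMap.fourierMultiplierCLM_apply]
  congr 3
  exact congrArg (fun g => SchwartzMap.smulLeftCLM ℂ g) h2

/-- The operator `1 + ∑ P_i²`. -/
def momSq (N : ℕ) : SchwartzEnd N := 1 + ∑ i, momOp i ^ 2

theorem momSq_eq : momSq N = fourierConj N (posSq N (2 * π)) := by
  simp [momSq, posSq, momOp_eq]

/-- The inverse of `1 + ∑ P_i²`. -/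
def momInv (N : ℕ) : SchwartzEnd N := fourierConj N (invOp N (2 * π))

theorem momInv_mul_momSq : momInv N * momSq N = 1 := by
  rw [momInv, momSq_eq, ← map_mul, invOp_mul_posSq, map_one]

theorem momSq_mul_momInv : momSq N * momInv N = 1 := by
  rw [momInv, momSq_eq, ← map_mul, posSq_mul_invOp, map_one]

theorem momInv_mem_boundedEnd : momInv N ∈ boundedEnd N :=
  fourierConj_mem_boundedEnd (invOp_mem_boundedEnd _)

theorem momOp_mul_momInv_mem_boundedEnd (i : Fin N) : momOp i * momInv N ∈ boundedEnd N := by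
  rw [momInv, momOp_eq, ← map_mul]
  exact fourierConj_mem_boundedEnd (posOp_mul_invOp_mem_boundedEnd _ i)

theorem isFormalAdjoint_momOp (i : Fin N) : IsFormalAdjoint (momOp i) (momOp i) := by
  rw [momOp_eq]
  have h := (isFormalAdjoint_posOp i).smul ((2 * π : ℝ) : ℂ)
  rw [Complex.conj_ofReal] at h
  exact h.fourierConj

/-! #### Commutation relations -/

theorem posOp_commute (i j : Fin N) : Commute (posOp i) (posOp j) := by
  ext φ q
  simp only [mul_apply_eq_comp, posOp_apply]
  ring

theorem momOp_commute (i j : Fin N) : Commute (momOp i) (momOp j) := by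
  rw [momOp_eq, momOp_eq]
  exact (((posOp_commute i j).smul_left _).smul_right _).map (fourierConj N)

theorem posOp_mul_momOp (i j : Fin N) :
    posOp i * momOp j = momOp j * posOp i + (if i = j then Complex.I else 0) • 1 := by
  ext φ q
  simp only [mul_apply_eq_comp, add_apply, smul_apply, one_apply_eq_self, posOp_apply, momOp_apply]
  have h1 : (posOp i φ : Conf N → ℂ) = fun q => ((q i : ℝ) : ℂ) * φ q :=
    funext fun q => posOp_apply i φ q
  have h2 : HasLineDerivAt ℝ (fun q : Conf N => ((q i : ℝ) : ℂ)) (if i = j then 1 else 0) q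
      (EuclideanSpace.single j 1) := by
    have := ((Complex.ofRealCLM ∘L (EuclideanSpace.proj i : Conf N →L[ℝ] ℝ)).hasFDerivAt
      (x := q)).hasLineDerivAt (EuclideanSpace.single j 1)
    convert! this using 1
    rcases eq_or_ne i j with h | h <;> simp [h]
  have h3 : HasLineDerivAt ℝ φ (lineDeriv ℝ φ q (EuclideanSpace.single j 1)) q
      (EuclideanSpace.single j 1) := φ.differentiableAt.lineDifferentiableAt.hasLineDerivAt
  have h4 : HasLineDerivAt ℝ (fun q : Conf N => ((q i : ℝ) : ℂ) * φ q) _ q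
    (EuclideanSpace.single j 1) := HasDerivAt.mul h2 h3
  rw [h1, h4.lineDeriv]
  simp only [zero_smul, add_zero, smul_eq_mul]
  split_ifs
  · ring
  · ring

end Operators

/-! ### The Weyl algebra -/

section Algebra

open Filter

variable {A : Type*} [Ring A] [Algebra ℂ A]

/-- Each generator in a word is paired with one factor `R`, which can be moved next to it by
commutation. Surplus factors of `R` lie in `B`. -/
theorem eventually_pow_mul_mem (B : Subalgebra ℂ A) {R : A} (hR : R ∈ B) {s : Set A}
    (hc : ∀ p ∈ s, Commute R p) (hs : ∀ p ∈ s, R * p ∈ B) {p : A}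
    (hp : p ∈ Algebra.adjoin ℂ s) : ∀ᶠ n in atTop, R ^ n * p ∈ B := by
  have hcomm : ∀ p ∈ Algebra.adjoin ℂ s, Commute R p := fun p hp => by
    have h : Algebra.adjoin ℂ s ≤ Subalgebra.centralizer ℂ {R} := by
      rw [Algebra.adjoin_le_iff]
      intro p hp
      rw [SetLike.mem_coe, Subalgebra.mem_centralizer_iff]
      rintro _ rfl
      exact (hc p hp).eq
    have := h hp
    rw [Subalgebra.mem_centralizer_iff] at this
    exact this R rfl
  induction hp using Algebra.adjoin_induction with
  | mem p hp =>
    filter_upwards [eventually_ge_atTop 1] with n hn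
    obtain ⟨k, rfl⟩ := Nat.exists_eq_add_of_le' hn
    rw [pow_succ, mul_assoc]
    exact B.mul_mem (B.pow_mem hR k) (hs p hp)
  | algebraMap c => exact .of_forall fun n => B.mul_mem (B.pow_mem hR n) (B.algebraMap_mem c)
  | add p q _ _ hp hq =>
    filter_upwards [hp, hq] with n h1 h2
    rw [mul_add]
    exact B.add_mem h1 h2
  | mul p q hp' _ hp hq =>
    obtain ⟨k, hk⟩ := hq.exists
    rw [← map_add_atTop_eq_nat k, eventually_map]
    filter_upwards [hp] with n hn
    have h : R ^ (n + k) * (p * q) = (R ^ n * p) * (R ^ k * q) := by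
      rw [pow_add, mul_assoc, ← mul_assoc (R ^ k), ((hcomm p hp').pow_left k).eq]
      simp only [mul_assoc]
    rw [h]
    exact B.mul_mem hn hk

/-- The commutator with `x` is a derivation, so the Leibniz rule reduces the claim to generators. -/
theorem commutator_mem_of_mem_adjoin (B : Subalgebra ℂ A) {x : A} {s : Set A}
    (hsB : Algebra.adjoin ℂ s ≤ B) (hs : ∀ a ∈ s, x * a - a * x ∈ B) {a : A}
    (ha : a ∈ Algebra.adjoin ℂ s) : x * a - a * x ∈ B := by
  induction ha using Algebra.adjoin_induction with
  | mem a ha => exact hs a ha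
  | algebraMap c => rw [Algebra.commutes, sub_self]; exact B.zero_mem
  | add a b _ _ h1 h2 =>
    have : x * (a + b) - (a + b) * x = (x * a - a * x) + (x * b - b * x) := by noncomm_ring
    rw [this]
    exact B.add_mem h1 h2
  | mul a b ha hb h1 h2 =>
    have : x * (a * b) - a * b * x = (x * a - a * x) * b + a * (x * b - b * x) := by noncomm_ring
    rw [this]
    exact B.add_mem (B.mul_mem h1 (hsB hb)) (B.mul_mem (hsB ha) h2)

/-- Moving `a` to the right past a generator, `a q = q a - [q, a]`, costs only another element of
`B`. -/
theorem mul_adjoin_mem_adjoin_mul (B : Subalgebra ℂ A) {s : Set A}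
    (hs : ∀ q ∈ s, ∀ a ∈ B, q * a - a * q ∈ B) {q : A} (hq : q ∈ Algebra.adjoin ℂ s) {a : A}
    (ha : a ∈ B) :
    a * q ∈ Subalgebra.toSubmodule (Algebra.adjoin ℂ s) * Subalgebra.toSubmodule B := by
  induction hq using Algebra.adjoin_induction generalizing a with
  | mem q hq =>
    have : a * q = q * a + 1 * -(q * a - a * q) := by noncomm_ring
    rw [this]
    exact add_mem (Submodule.mul_mem_mul (Algebra.subset_adjoin hq) ha)
      (Submodule.mul_mem_mul (one_mem (Algebra.adjoin ℂ s)) (neg_mem (hs q hq a ha)))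
  | algebraMap c =>
    rw [← Algebra.commutes]
    exact Submodule.mul_mem_mul (Subalgebra.algebraMap_mem _ c) ha
  | add p q _ _ hp hq =>
    rw [mul_add]
    exact add_mem (hp ha) (hq ha)
  | mul p q hp' _ hp hq =>
    rw [← mul_assoc]
    refine Submodule.mul_induction_on (hp ha) (fun m hm n hn => ?_) fun m n hm hn => ?_
    · rw [mul_assoc]
      have h1 := Submodule.mul_mem_mul hm (hq hn)
      rwa [← mul_assoc, (Subalgebra.isIdempotentElem_toSubmodule _).eq] at h1
    · rw [add_mul]
      exact add_mem hm hn

/-- The right-hand side contains `1` and is stable under left multiplication by generators. For `x ∈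
t` this follows from `x p q = p (x q) + [x, p] q`. -/
theorem adjoin_union_le_mul {s t : Set A}
    (h : ∀ x ∈ t, ∀ p ∈ Algebra.adjoin ℂ s, x * p - p * x ∈ Algebra.adjoin ℂ s) :
    Subalgebra.toSubmodule (Algebra.adjoin ℂ (s ∪ t)) ≤
      Subalgebra.toSubmodule (Algebra.adjoin ℂ s) * Subalgebra.toSubmodule (Algebra.adjoin ℂ t) := by
  intro x hx
  rw [Subalgebra.mem_toSubmodule] at hx
  have key : ∀ v ∈ Subalgebra.toSubmodule (Algebra.adjoin ℂ s) *
      Subalgebra.toSubmodule (Algebra.adjoin ℂ t), x * v ∈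
      Subalgebra.toSubmodule (Algebra.adjoin ℂ s) *
      Subalgebra.toSubmodule (Algebra.adjoin ℂ t) := by
    induction hx using Algebra.adjoin_induction with
    | mem x hx =>
      intro v hv
      refine Submodule.mul_induction_on hv (fun p hp q hq => ?_) fun m n hm hn => ?_
      · rcases hx with hx | hx
        · rw [← mul_assoc]
          exact Submodule.mul_mem_mul
            ((Algebra.adjoin ℂ s).mul_mem (Algebra.subset_adjoin hx) hp) hq
        · have : x * (p * q) = p * (x * q) + (x * p - p * x) * q := by noncomm_ring
          rw [this]
          exact add_mem (Submodule.mul_mem_mul hp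
            ((Algebra.adjoin ℂ t).mul_mem (Algebra.subset_adjoin hx) hq))
            (Submodule.mul_mem_mul (h x hx p hp) hq)
      · rw [mul_add]
        exact add_mem hm hn
    | algebraMap c =>
      intro v hv
      rw [← Algebra.smul_def]
      exact Submodule.smul_mem _ c hv
    | add x y _ _ hx hy =>
      intro v hv
      rw [add_mul]
      exact add_mem (hx v hv) (hy v hv)
    | mul x y _ _ hx hy =>
      intro v hv
      rw [mul_assoc]
      exact hx _ (hy v hv)
  have h1 := Submodule.mul_mem_mul ((Subalgebra.mem_toSubmodule _).2 (one_mem (Algebra.adjoin ℂ s)))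
    ((Subalgebra.mem_toSubmodule _).2 (one_mem (Algebra.adjoin ℂ t)))
  rw [one_mul] at h1
  simpa only [mul_one] using key 1 h1

theorem mul_prod_ofFn_pow {A : Type*} [Monoid A] {N : ℕ} (x : Fin N → A)
    (hx : ∀ i j, Commute (x i) (x j))
    (α : Fin N → ℕ) (j : Fin N) :
    x j * (List.ofFn fun i => x i ^ α i).prod =
      (List.ofFn fun i => x i ^ (α i + if i = j then 1 else 0)).prod := by
  induction N with
  | zero => exact j.elim0
  | succ N ih =>
    rw [List.ofFn_succ, List.ofFn_succ, List.prod_cons, List.prod_cons]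
    refine Fin.cases ?_ (fun k => ?_) j
    · simp [← mul_assoc, pow_succ']
    · have h := ih (fun i => x i.succ) (fun _ _ => hx _ _) (fun i => α i.succ) k
      rw [← mul_assoc, ((hx k.succ 0).pow_right _).eq, mul_assoc, h]
      simp [(Fin.succ_ne_zero k).symm]

theorem adjoin_range_le_span {N : ℕ} (x : Fin N → A) (hx : ∀ i j, Commute (x i) (x j)) :
    Subalgebra.toSubmodule (Algebra.adjoin ℂ (Set.range x)) ≤
      Submodule.span ℂ (Set.range fun α : Fin N → ℕ => (List.ofFn fun i => x i ^ α i).prod) := by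
  intro p hp
  rw [Subalgebra.mem_toSubmodule] at hp
  set V := Submodule.span ℂ (Set.range fun α : Fin N → ℕ => (List.ofFn fun i => x i ^ α i).prod)
  have key : ∀ v ∈ V, p * v ∈ V := by
    induction hp using Algebra.adjoin_induction with
    | mem p hp =>
      obtain ⟨j, rfl⟩ := hp
      intro v hv
      induction hv using Submodule.span_induction with
      | mem v hv =>
        obtain ⟨α, rfl⟩ := hv
        rw [mul_prod_ofFn_pow x hx]
        exact Submodule.subset_span ⟨fun i => α i + if i = j then 1 else 0, rfl⟩
      | zero => rw [mul_zero]; exact V.zero_mem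
      | add u v _ _ hu hv => rw [mul_add]; exact V.add_mem hu hv
      | smul c v _ hv => rw [mul_smul_comm]; exact V.smul_mem c hv
    | algebraMap c =>
      intro v hv
      rw [← Algebra.smul_def]
      exact V.smul_mem c hv
    | add x y _ _ hx hy =>
      intro v hv
      rw [add_mul]
      exact V.add_mem (hx v hv) (hy v hv)
    | mul x y _ _ hx hy =>
      intro v hv
      rw [mul_assoc]
      exact hx _ (hy v hv)
  have h1 : (1 : A) ∈ V := Submodule.subset_span ⟨0, by simp⟩
  simpa using key 1 h1

end Algebra

/-! ### Normal ordering in the Weyl algebra and absorption of polynomials by resolvents. -/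

section Weyl

open Filter

variable {N : ℕ}

/-- The algebra of polynomials in position and momentum operators. -/
def weylAlgebra (N : ℕ) : Subalgebra ℂ (SchwartzEnd N) :=
  Algebra.adjoin ℂ (Set.range momOp ∪ Set.range posOp)

theorem posOp_mem_weylAlgebra (i : Fin N) : posOp i ∈ weylAlgebra N :=
  Algebra.subset_adjoin (Or.inr ⟨i, rfl⟩)

theorem momOp_mem_weylAlgebra (i : Fin N) : momOp i ∈ weylAlgebra N :=
  Algebra.subset_adjoin (Or.inl ⟨i, rfl⟩)

theorem polyOp_mem_weylAlgebra (f : FreeAlgebra ℂ (Fin N ⊕ Fin N)) : polyOp f ∈ weylAlgebra N := by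
  unfold polyOp
  induction f using FreeAlgebra.induction with
  | grade0 c => rw [AlgHom.commutes]; exact (weylAlgebra N).algebraMap_mem c
  | grade1 x =>
    rw [FreeAlgebra.lift_ι_apply]
    rcases x with i | i
    · exact posOp_mem_weylAlgebra i
    · exact momOp_mem_weylAlgebra i
  | mul f g hf hg => rw [map_mul]; exact mul_mem hf hg
  | add f g hf hg => rw [map_add]; exact add_mem hf hg

theorem exists_polyOp_eq {M : SchwartzEnd N} (hM : M ∈ weylAlgebra N) : ∃ f, polyOp f = M := by
  have h : weylAlgebra N ≤
      (FreeAlgebra.lift ℂ (Sum.elim posOp momOp : Fin N ⊕ Fin N → SchwartzEnd N)).range := by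
    refine Algebra.adjoin_le ?_
    rintro _ (⟨i, rfl⟩ | ⟨i, rfl⟩)
    · exact ⟨FreeAlgebra.ι ℂ (Sum.inr i), by simp⟩
    · exact ⟨FreeAlgebra.ι ℂ (Sum.inl i), by simp⟩
  exact h hM

theorem posSq_mem_weylAlgebra (c : ℝ) : posSq N c ∈ weylAlgebra N :=
  add_mem (one_mem _) (sum_mem fun i _ =>
    pow_mem (Subalgebra.smul_mem _ (posOp_mem_weylAlgebra i) _) 2)

theorem momSq_mem_weylAlgebra : momSq N ∈ weylAlgebra N :=
  add_mem (one_mem _) (sum_mem fun i _ => pow_mem (momOp_mem_weylAlgebra i) 2)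

theorem exists_formalAdjoint {M : SchwartzEnd N} (hM : M ∈ weylAlgebra N) :
    ∃ M' ∈ weylAlgebra N, IsFormalAdjoint M M' := by
  induction hM using Algebra.adjoin_induction with
  | mem M hM =>
    rcases hM with ⟨i, rfl⟩ | ⟨i, rfl⟩
    · exact ⟨_, momOp_mem_weylAlgebra i, isFormalAdjoint_momOp i⟩
    · exact ⟨_, posOp_mem_weylAlgebra i, isFormalAdjoint_posOp i⟩
  | algebraMap c =>
    rw [Algebra.algebraMap_eq_smul_one]
    exact ⟨_, Subalgebra.smul_mem _ (one_mem _) _, IsFormalAdjoint.one.smul c⟩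
  | add A B _ _ hA hB =>
    obtain ⟨A', hA', hA⟩ := hA
    obtain ⟨B', hB', hB⟩ := hB
    exact ⟨_, add_mem hA' hB', hA.add hB⟩
  | mul A B _ _ hA hB =>
    obtain ⟨A', hA', hA⟩ := hA
    obtain ⟨B', hB', hB⟩ := hB
    exact ⟨_, mul_mem hB' hA', hA.mul hB⟩

theorem commutator_posOp_mem_adjoin_momOp {x : SchwartzEnd N} (hx : x ∈ Set.range posOp)
    {p : SchwartzEnd N} (hp : p ∈ Algebra.adjoin ℂ (Set.range momOp)) :
    x * p - p * x ∈ Algebra.adjoin ℂ (Set.range (momOp : Fin N → SchwartzEnd N)) := by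
  obtain ⟨i, rfl⟩ := hx
  refine commutator_mem_of_mem_adjoin _ le_rfl ?_ hp
  rintro _ ⟨j, rfl⟩
  rw [posOp_mul_momOp, add_sub_cancel_left]
  exact Subalgebra.smul_mem _ (one_mem _) _

/-- Normal ordering. -/
theorem weylAlgebra_le_span : Subalgebra.toSubmodule (weylAlgebra N) ≤
    Submodule.span ℂ (Set.range fun m : (Fin N → ℕ) × (Fin N → ℕ) => momMon m.1 * posMon m.2) := by
  refine (adjoin_union_le_mul fun x hx p hp => commutator_posOp_mem_adjoin_momOp hx hp).trans ?_
  refine (mul_le_mul' (adjoin_range_le_span momOp momOp_commute)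
    (adjoin_range_le_span posOp posOp_commute)).trans ?_
  rw [Submodule.span_mul_span]
  refine Submodule.span_mono ?_
  rintro _ ⟨_, ⟨β, rfl⟩, _, ⟨α, rfl⟩, rfl⟩
  exact ⟨(β, α), rfl⟩

/-- The algebra generated by the bounded functions `(1 + |p|²)⁻¹` and `p_i (1 + |p|²)⁻¹` of the
momentum. -/
def momSymbols (N : ℕ) : Subalgebra ℂ (SchwartzEnd N) :=
  Algebra.adjoin ℂ ({momInv N} ∪ Set.range fun i => momOp i * momInv N)

theorem momInv_mem_momSymbols : momInv N ∈ momSymbols N :=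
  Algebra.subset_adjoin (Or.inl rfl)

theorem momOp_mul_momInv_mem_momSymbols (i : Fin N) : momOp i * momInv N ∈ momSymbols N :=
  Algebra.subset_adjoin (Or.inr ⟨i, rfl⟩)

theorem momSymbols_le_boundedEnd : momSymbols N ≤ boundedEnd N := by
  refine Algebra.adjoin_le ?_
  rintro _ (rfl | ⟨i, rfl⟩)
  · exact momInv_mem_boundedEnd
  · exact momOp_mul_momInv_mem_boundedEnd i

theorem commute_of_inverse {A : Type*} [Ring A] {F R x : A} (h1 : F * R = 1) (h2 : R * F = 1)
    (h : Commute F x) : Commute R x := by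
  calc R * x = R * x * (F * R) := by rw [h1, mul_one]
    _ = R * (F * x) * R := by rw [h.eq]; simp only [mul_assoc]
    _ = x * R := by rw [← mul_assoc, h2, one_mul]

theorem momInv_commute (i : Fin N) : Commute (momInv N) (momOp i) :=
  commute_of_inverse momSq_mul_momInv momInv_mul_momSq
    ((Commute.one_left _).add_left (Commute.sum_left _ _ _ fun j _ =>
      (momOp_commute j i).pow_left 2))

theorem invOp_commute (c : ℝ) (i : Fin N) : Commute (invOp N c) (posOp i) :=
  commute_of_inverse (posSq_mul_invOp c) (invOp_mul_posSq c)
    ((Commute.one_left _).add_left (Commute.sum_left _ _ _ fun j _ =>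
      ((posOp_commute j i).smul_left _).pow_left 2))

theorem posOp_mul_momSq (i : Fin N) :
    posOp i * momSq N = momSq N * posOp i + (2 * Complex.I) • momOp i := by
  have h : ∀ j, posOp i * momOp j ^ 2 =
      momOp j ^ 2 * posOp i + if i = j then (2 * Complex.I) • momOp i else 0 := fun j => by
    rw [pow_two, ← mul_assoc, posOp_mul_momOp, add_mul, mul_assoc, posOp_mul_momOp, mul_add,
      ← mul_assoc, add_assoc]
    congr 1
    split_ifs with hij
    · subst hij
      rw [mul_smul_comm, smul_mul_assoc, mul_one, one_mul, ← add_smul, two_mul]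
    · simp
  rw [momSq, mul_add, add_mul, mul_one, one_mul, Finset.mul_sum, Finset.sum_mul,
    Finset.sum_congr rfl fun j _ => h j, Finset.sum_add_distrib, add_assoc]
  simp

/-- Multiply `[Q_i, 1 + ∑ P_j²] = 2i P_i` by the inverse of `1 + ∑ P_j²` on both sides. -/
theorem commutator_posOp_momInv (i : Fin N) :
    posOp i * momInv N - momInv N * posOp i =
      (-(2 * Complex.I)) • (momInv N * (momOp i * momInv N)) := by
  have h := congrArg (fun B => momInv N * B * momInv N) (posOp_mul_momSq (N := N) i)
  simp only [mul_add, add_mul, mul_smul_comm, smul_mul_assoc] at h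
  rw [← mul_assoc (momInv N) (momSq N), momInv_mul_momSq, one_mul, mul_assoc, mul_assoc (posOp i),
    momSq_mul_momInv, mul_one, mul_assoc (momInv N) (momOp i)] at h
  rw [h, neg_smul]
  abel

/-- This stability is the reason for introducing `momSymbols`: its elements are bounded, and moving
them past `Q_i` never leaves the algebra. -/
theorem commutator_posOp_mem_momSymbols {x : SchwartzEnd N} (hx : x ∈ Set.range posOp)
    {a : SchwartzEnd N} (ha : a ∈ momSymbols N) : x * a - a * x ∈ momSymbols N := by
  obtain ⟨i, rfl⟩ := hx
  refine commutator_mem_of_mem_adjoin (momSymbols N) le_rfl ?_ ha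
  rintro _ (rfl | ⟨j, rfl⟩)
  · rw [commutator_posOp_momInv]
    exact Subalgebra.smul_mem _ (mul_mem momInv_mem_momSymbols
      (momOp_mul_momInv_mem_momSymbols i)) _
  · have h : posOp i * (momOp j * momInv N) - momOp j * momInv N * posOp i =
        momOp j * (posOp i * momInv N - momInv N * posOp i) +
          (posOp i * momOp j - momOp j * posOp i) * momInv N := by noncomm_ring
    simp only [h]
    rw [commutator_posOp_momInv, posOp_mul_momOp, add_sub_cancel_left, mul_smul_comm,
      smul_mul_assoc, one_mul, ← mul_assoc]
    exact add_mem (Subalgebra.smul_mem _ (mul_mem (momOp_mul_momInv_mem_momSymbols j)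
      (momOp_mul_momInv_mem_momSymbols i)) _) (Subalgebra.smul_mem _ momInv_mem_momSymbols _)

/-- Resolvents of high order compensate a polynomial in position and momentum. -/
theorem eventually_resolvent_mul_mem_boundedEnd {M : SchwartzEnd N} (hM : M ∈ weylAlgebra N) :
    ∀ᶠ n in atTop, ∀ᶠ k in atTop, invOp N 1 ^ k * momInv N ^ n * M ∈ boundedEnd N := by
  refine Submodule.mul_induction_on
    (adjoin_union_le_mul (fun x hx p hp => commutator_posOp_mem_adjoin_momOp hx hp) hM)
    (fun p hp q hq => ?_) fun x y hx hy => ?_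
  · have h1 : ∀ᶠ n in atTop, momInv N ^ n * p ∈ momSymbols N := by
      refine eventually_pow_mul_mem _ momInv_mem_momSymbols ?_ ?_ hp
      · rintro _ ⟨i, rfl⟩
        exact momInv_commute i
      · rintro _ ⟨i, rfl⟩
        rw [(momInv_commute i).eq]
        exact momOp_mul_momInv_mem_momSymbols i
    filter_upwards [h1] with n hn
    -- The bounded momentum factor is moved to the right of `q`, which leaves sums of `q' a` with
    -- `q'` a polynomial in position. As `q'` depends on `n`, the power `k` of the position
    -- resolvent is chosen after `n`.
    have h2 := mul_adjoin_mem_adjoin_mul (momSymbols N)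
      (fun x hx a ha => commutator_posOp_mem_momSymbols hx ha) hq hn
    rw [mul_assoc] at h2
    simp_rw [mul_assoc]
    refine Submodule.mul_induction_on h2 (fun q' hq' a ha => ?_) fun x y hx hy => ?_
    · have h3 : ∀ᶠ k in atTop, invOp N 1 ^ k * q' ∈ boundedEnd N := by
        refine eventually_pow_mul_mem _ (invOp_mem_boundedEnd 1) ?_ ?_ hq'
        · rintro _ ⟨i, rfl⟩
          exact invOp_commute 1 i
        · rintro _ ⟨i, rfl⟩
          have := posOp_mul_invOp_mem_boundedEnd 1 i
          rwa [Complex.ofReal_one, one_smul, ← (invOp_commute 1 i).eq] at this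
      filter_upwards [h3] with k hk
      rw [← mul_assoc]
      exact mul_mem hk (momSymbols_le_boundedEnd ha)
    · filter_upwards [hx, hy] with k h1 h2
      rw [mul_add]
      exact add_mem h1 h2
  · filter_upwards [hx, hy] with n h1 h2
    filter_upwards [h1, h2] with k h1 h2
    rw [mul_add]
    exact add_mem h1 h2

end Weyl

/-! ### Sobolev estimates -/

section Sobolev

open FourierTransform Filter Topology
open scoped ENNReal

variable {N : ℕ}

theorem resolvent_nonneg (c : ℝ) (q : Conf N) : 0 ≤ resolvent N c q := by
  unfold resolvent; positivity

theorem continuous_resolvent (c : ℝ) : Continuous (resolvent N c) := by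
  unfold resolvent
  exact Continuous.inv₀ (by fun_prop) fun q => by positivity

theorem integrable_resolvent_pow_sq {c : ℝ} (hc : 1 ≤ c) {m : ℕ} (hm : N < m) :
    Integrable fun q => (resolvent N c q ^ m) ^ 2 := by
  -- The integrand is at most `(1 + |q|²)^(-2m)`, which decays like `|q|^(-4m)`.
  have h : (Module.finrank ℝ (Conf N) : ℝ) < 4 * m := by
    rw [finrank_euclideanSpace_fin]
    have : (N : ℝ) < m := by exact_mod_cast hm
    have h0 : (0 : ℝ) ≤ N := by positivity
    linarith
  refine (integrable_rpow_neg_one_add_norm_sq (μ := volume) h).mono'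
    (((continuous_resolvent c).pow m).pow 2).aestronglyMeasurable (.of_forall fun q => ?_)
  rw [Real.norm_of_nonneg (by positivity), ← pow_mul, show -(4 * (m : ℝ)) / 2 = -((m * 2 : ℕ) : ℝ) by
    push_cast; ring, Real.rpow_neg (by positivity), Real.rpow_natCast, ← inv_pow]
  refine pow_le_pow_left₀ (resolvent_nonneg c q) ?_ _
  refine inv_anti₀ (by positivity) ?_
  rw [mul_pow]
  nlinarith [sq_nonneg ‖q‖, one_le_pow₀ (n := 2) hc]

theorem invOp_pow_apply (c : ℝ) (m : ℕ) (φ : SFun N) (q : Conf N) :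
    (invOp N c ^ m) φ q = ((resolvent N c q ^ m : ℝ) : ℂ) * φ q := by
  induction m generalizing φ with
  | zero => simp
  | succ m ih =>
    rw [pow_succ, mul_apply_eq_comp, ih, invOp_apply, pow_succ]
    push_cast
    ring

theorem Lp_norm_sq (f : Hil N) : ‖f‖ ^ 2 = ∫ x, ‖f x‖ ^ 2 := by
  have h := L2.inner_def (𝕜 := ℂ) f f
  rw [inner_self_eq_norm_sq_to_K] at h
  simp_rw [inner_self_eq_norm_sq_to_K] at h
  have h2 := integral_ofReal (𝕜 := ℂ) (f := fun x => ‖f x‖ ^ 2) (μ := volume)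
  simp only [RCLike.ofReal_pow] at h2
  have h3 := h.trans h2
  rw [← RCLike.ofReal_pow] at h3
  exact RCLike.ofReal_inj.1 h3

theorem norm_vec_sq (φ : SFun N) : ‖vec φ‖ ^ 2 = ∫ x, ‖φ x‖ ^ 2 := by
  rw [Lp_norm_sq]
  refine integral_congr_ae ?_
  filter_upwards [SchwartzMap.coeFn_toLp φ 2 volume] with x hx
  rw [hx]

theorem norm_fourierInv_apply_le (φ : SFun N) (x : Conf N) : ‖𝓕⁻ φ x‖ ≤ ∫ ξ, ‖φ ξ‖ := by
  rw [SchwartzMap.fourierInv_coe, Real.fourierInv_eq]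
  refine (norm_integral_le_integral_norm _).trans_eq ?_
  simp

/-- A Sobolev inequality. -/
theorem exists_norm_momInv_pow_apply_le {m : ℕ} (hm : N < m) :
    ∃ C, 0 ≤ C ∧ ∀ (φ : SFun N) x, ‖(momInv N ^ m) φ x‖ ≤ C * ‖vec φ‖ := by
  refine ⟨Real.sqrt (∫ q : Conf N, (resolvent N (2 * Real.pi) q ^ m) ^ 2), Real.sqrt_nonneg _,
    fun φ x => ?_⟩
  have hc : (1 : ℝ) ≤ 2 * Real.pi := by linarith [Real.pi_gt_three]
  rw [momInv, ← map_pow, fourierConj_apply]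
  refine (norm_fourierInv_apply_le _ _).trans ?_
  simp_rw [invOp_pow_apply, norm_mul, Complex.norm_real,
    Real.norm_of_nonneg (pow_nonneg (resolvent_nonneg (2 * Real.pi) _) m)]
  have h1 : MemLp (fun q => resolvent N (2 * Real.pi) q ^ m) (ENNReal.ofReal 2) volume := by
    rw [ENNReal.ofReal_ofNat]
    exact (memLp_two_iff_integrable_sq
      ((continuous_resolvent _).pow m).aestronglyMeasurable).2 (integrable_resolvent_pow_sq hc hm)
  have h2 : MemLp (fun q => ‖𝓕 φ q‖) (ENNReal.ofReal 2) volume := by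
    rw [ENNReal.ofReal_ofNat]
    exact ((𝓕 φ).memLp 2 volume).norm
  -- Cauchy-Schwarz on the Fourier side. The constant `C` is the `L²` norm of the resolvent power.
  have h := integral_mul_le_Lp_mul_Lq_of_nonneg Real.HolderConjugate.two_two
    (.of_forall fun q => pow_nonneg (resolvent_nonneg (2 * Real.pi) q) m)
    (.of_forall fun q => norm_nonneg (𝓕 φ q)) h1 h2
  refine h.trans_eq ?_
  simp_rw [Real.rpow_ofNat, ← Real.sqrt_eq_rpow, ← norm_vec_sq, norm_vec_fourier]
  rw [Real.sqrt_sq (norm_nonneg _)]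

/-- The differential of `φ` is `∑ i P_jφ dq_j`, and each map `z ↦ i z dq_j` has norm at most one.
One derivative is thus traded for one momentum operator. -/
theorem norm_iteratedFDeriv_succ_le (n : ℕ) (φ : SFun N) (x : Conf N) :
    ‖iteratedFDeriv ℝ (n + 1) φ x‖ ≤ ∑ i, ‖iteratedFDeriv ℝ n (momOp i φ) x‖ := by
  let L : Fin N → ℂ →L[ℝ] (Conf N →L[ℝ] ℂ) := fun i =>
    ContinuousLinearMap.smulRightL ℝ (Conf N) ℂ (EuclideanSpace.proj i) ∘L
      (ContinuousLinearMap.mul ℝ ℂ Complex.I)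
  have hLa : ∀ i z y, L i z y = y i • (Complex.I * z) := fun _ _ _ => rfl
  have hL : ∀ i, ‖L i‖ ≤ 1 := fun i => by
    refine ContinuousLinearMap.opNorm_le_bound _ zero_le_one fun z => ?_
    refine ContinuousLinearMap.opNorm_le_bound _ (by positivity) fun y => ?_
    rw [hLa, norm_smul, norm_mul, Complex.norm_I, one_mul, mul_comm]
    exact mul_le_mul_of_nonneg_left (PiLp.norm_apply_le y i) (norm_nonneg z)
  have h1 : fderiv ℝ φ = fun y => ∑ i, L i (momOp i φ y) := by
    funext y
    refine ContinuousLinearMap.ext fun v => ?_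
    have hv : v = ∑ i, v i • EuclideanSpace.single i (1 : ℝ) := by
      ext j
      simp [Finset.sum_apply, Pi.single_apply]
    conv_lhs => rw [hv, map_sum]
    rw [sum_apply]
    refine Finset.sum_congr rfl fun i _ => ?_
    rw [hLa, map_smul, momOp_apply, φ.differentiableAt.lineDeriv_eq_fderiv, ← mul_assoc, mul_neg,
      Complex.I_mul_I, neg_neg, one_mul]
  rw [← norm_iteratedFDeriv_fderiv, h1]
  have h3 : (fun y => ∑ i, L i (momOp i φ y)) = ∑ i, fun y => L i (momOp i φ y) := by
    funext y
    rw [Finset.sum_apply]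
  rw [h3]
  have h2 : ∀ i, ContDiffAt ℝ n (fun y => L i (momOp i φ y)) x := fun i =>
    ((L i).contDiff.comp ((momOp i φ).smooth n)).contDiffAt
  rw [iteratedFDeriv_sum_apply fun i _ => h2 i]
  refine (norm_sum_le _ _).trans (Finset.sum_le_sum fun i _ => ?_)
  refine ((L i).norm_iteratedFDeriv_comp_left ((momOp i φ).contDiffAt n) le_rfl).trans ?_
  exact mul_le_of_le_one_left (norm_nonneg _) (hL i)

theorem seminorm_succ_le (k n : ℕ) (φ : SFun N) :
    SchwartzMap.seminorm ℝ k (n + 1) φ ≤ ∑ i, SchwartzMap.seminorm ℝ k n (momOp i φ) := by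
  refine SchwartzMap.seminorm_le_bound ℝ k _ _ (Finset.sum_nonneg fun i _ => apply_nonneg _ _)
    fun x => ?_
  refine (mul_le_mul_of_nonneg_left (norm_iteratedFDeriv_succ_le n φ x) (by positivity)).trans ?_
  rw [Finset.mul_sum]
  exact Finset.sum_le_sum fun i _ => SchwartzMap.le_seminorm ℝ k n (momOp i φ) x

/-- The weight `|x|^k` is dominated by `(1 + |x|²)^k`, that is, by `posSq N 1 ^ k`. The Sobolev
inequality with exponent `N + 1` then bounds the supremum. -/
theorem exists_seminorm_zero_le (k : ℕ) : ∃ C, ∀ φ : SFun N,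
    SchwartzMap.seminorm ℝ k 0 φ ≤ C * ‖vec ((momSq N ^ (N + 1) * posSq N 1 ^ k) φ)‖ := by
  obtain ⟨C, hC, h⟩ := exists_norm_momInv_pow_apply_le (Nat.lt_succ_self N)
  refine ⟨C, fun φ => SchwartzMap.seminorm_le_bound ℝ k 0 _ (by positivity) fun x => ?_⟩
  have h1 := h ((momSq N ^ (N + 1) * posSq N 1 ^ k) φ) x
  have h2 : momInv N ^ (N + 1) * momSq N ^ (N + 1) = 1 := by
    have hc : Commute (momInv N) (momSq N) := momInv_mul_momSq.trans momSq_mul_momInv.symm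
    rw [← hc.mul_pow, momInv_mul_momSq, one_pow]
  rw [← mul_apply_eq_comp, ← mul_assoc, h2, one_mul] at h1
  refine le_trans ?_ h1
  have h3 : ∀ k : ℕ, ∀ φ : SFun N, (posSq N 1 ^ k) φ x = ((1 + ‖x‖ ^ 2) ^ k : ℝ) * φ x := by
    intro k
    induction k with
    | zero => simp
    | succ k ih =>
      intro φ
      rw [pow_succ, mul_apply_eq_comp, ih, posSq_apply, pow_succ, one_mul]
      push_cast
      ring
  rw [h3, norm_mul, Complex.norm_real, norm_iteratedFDeriv_zero, Real.norm_of_nonneg (by positivity)]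
  refine mul_le_mul_of_nonneg_right (pow_le_pow_left₀ (norm_nonneg _) ?_ _) (norm_nonneg _)
  nlinarith [sq_nonneg (‖x‖ - 1), sq_nonneg ‖x‖]

/-- The topology of the Schwartz space is finer than the one of the `L²` norms of `M φ`, `M` in
the Weyl algebra. -/
theorem tendsto_zero_of_weylAlgebra {α : Type*} {l : Filter α} {u : α → SFun N}
    (h : ∀ M ∈ weylAlgebra N, Tendsto (fun a => vec (M (u a))) l (𝓝 0)) : Tendsto u l (𝓝 0) := by
  have key : ∀ n k : ℕ, ∀ u : α → SFun N,
      (∀ M ∈ weylAlgebra N, Tendsto (fun a => vec (M (u a))) l (𝓝 0)) →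
      Tendsto (fun a => SchwartzMap.seminorm ℝ k n (u a)) l (𝓝 0) := by
    intro n
    induction n with
    | zero =>
      intro k u h
      obtain ⟨C, hC⟩ := exists_seminorm_zero_le (N := N) k
      have h1 := (h (momSq N ^ (N + 1) * posSq N 1 ^ k)
        (mul_mem (pow_mem momSq_mem_weylAlgebra _) (pow_mem (posSq_mem_weylAlgebra 1) _))).norm
      rw [norm_zero] at h1
      have h2 := h1.const_mul C
      rw [mul_zero] at h2
      exact squeeze_zero (fun a => apply_nonneg _ _) (fun a => hC _) h2
    | succ n ih =>
      intro k u h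
      have h1 : Tendsto (fun a => ∑ i, SchwartzMap.seminorm ℝ k n (momOp i (u a))) l
          (𝓝 (∑ _i : Fin N, 0)) :=
        tendsto_finsetSum _ fun i _ => ih k (fun a => momOp i (u a)) fun M hM =>
          h (M * momOp i) (mul_mem hM (momOp_mem_weylAlgebra i))
      rw [Finset.sum_const_zero] at h1
      exact squeeze_zero (fun a => apply_nonneg _ _) (fun a => seminorm_succ_le _ _ _) h1
  rw [(schwartz_withSeminorms ℝ (Conf N) ℂ).tendsto_nhds]
  rintro ⟨k, n⟩ ε hε
  simp_rw [sub_zero]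
  exact (key n k u h).eventually (gt_mem_nhds hε)

/-! ### A criterion for Hilbert-Schmidt operators -/

/-- Evaluation `φ ↦ B φ x` is bounded in `L²`, hence given by a vector of norm at most `|w x|`, the
integral kernel at `x`. Bessel's inequality gives `∑ |K (e i) x|² ≤ w x ^ 2` for almost every `x`,
and this is integrated. -/
theorem isHilbertSchmidt_of_pointwise {B : SchwartzEnd N} {K : Hil N →L[ℂ] Hil N}
    (hK : ∀ φ, K (vec φ) = vec (B φ)) {w : Conf N → ℝ} (hw : Integrable fun x => w x ^ 2)
    (hB : ∀ φ x, ‖B φ x‖ ≤ w x * ‖vec φ‖) : IsHilbertSchmidt K := by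
  let b : Conf N → SFun N →ₗ[ℂ] ℂ := fun x =>
    { toFun := fun φ => B φ x
      map_add' := fun φ ψ => by rw [map_add, add_apply]
      map_smul' := fun c φ => by rw [map_smul, smul_apply]; rfl }
  let E : Conf N → Hil N →L[ℂ] ℂ := fun x => (b x).extendOfNorm (vecL N : SFun N →ₗ[ℂ] Hil N)
  have hE : ∀ x φ, E x (vec φ) = B φ x := fun x φ =>
    LinearMap.extendOfNorm_eq denseRange_vec ⟨w x, fun φ => hB φ x⟩ φ
  have hEn : ∀ x u, ‖E x u‖ ≤ w x * ‖u‖ := fun x u =>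
    LinearMap.norm_extendOfNorm_apply_le denseRange_vec (w x) (fun φ => hB φ x) u
  -- `L²` approximation of `u` by Schwartz functions gives almost everywhere convergence only along
  -- a subsequence, while `E x` is continuous for every `x`.
  have hKE : ∀ u, ∀ᵐ x, K u x = E x u := by
    intro u
    obtain ⟨v, hv, hvu⟩ := mem_closure_iff_seq_limit.1 (denseRange_vec u)
    choose φ hφ using hv
    have hφ' : ∀ j, vec (φ j) = v j := hφ
    have h1 : Tendsto (fun j => vec (B (φ j))) atTop (𝓝 (K u)) := by
      simp_rw [← hK, hφ']
      exact (K.continuous.tendsto u).comp hvu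
    obtain ⟨ns, hns, h2⟩ := (tendstoInMeasure_of_tendsto_Lp h1).exists_seq_tendsto_ae
    have h3 : ∀ᵐ x, ∀ j, vec (B (φ j)) x = B (φ j) x :=
      ae_all_iff.2 fun j => SchwartzMap.coeFn_toLp (B (φ j)) 2 volume
    filter_upwards [h2, h3] with x h2 h3
    refine tendsto_nhds_unique h2 ?_
    have h4 : Tendsto (fun j => E x (vec (φ (ns j)))) atTop (𝓝 (E x u)) := by
      simp_rw [hφ']
      exact ((E x).continuous.tendsto u).comp (hvu.comp hns.tendsto_atTop)
    refine h4.congr fun j => ?_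
    rw [hE, h3]
  obtain ⟨s, e, -⟩ := exists_hilbertBasis ℂ (Hil N)
  refine ⟨s, e, summable_of_sum_le (c := ∫ x, w x ^ 2) (fun i => sq_nonneg _) fun t => ?_⟩
  simp_rw [Lp_norm_sq]
  have hi : ∀ u : Hil N, Integrable fun x => ‖u x‖ ^ 2 := fun u =>
    (memLp_two_iff_integrable_sq_norm (Lp.aestronglyMeasurable u)).1 (Lp.memLp u)
  rw [← integral_finsetSum _ fun i _ => hi _]
  refine integral_mono_ae (integrable_finsetSum _ fun i _ => hi _) hw ?_
  have h : ∀ᵐ x, ∀ i ∈ t, K (e i) x = E x (e i) :=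
    (Finset.eventually_all t).2 fun i _ => hKE (e i)
  filter_upwards [h] with x hx
  let a := (InnerProductSpace.toDual ℂ (Hil N)).symm (E x)
  have ha : ∀ u, E x u = inner ℂ a u := fun u =>
    (InnerProductSpace.toDual_symm_apply).symm
  have hw0 : ‖a‖ ≤ |w x| := by
    rw [LinearIsometryEquiv.norm_map]
    refine ContinuousLinearMap.opNorm_le_bound _ (abs_nonneg _) fun u => (hEn x u).trans ?_
    exact mul_le_mul_of_nonneg_right (le_abs_self _) (norm_nonneg u)
  calc ∑ i ∈ t, ‖K (e i) x‖ ^ 2 = ∑ i ∈ t, ‖inner ℂ (e i) a‖ ^ 2 :=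
        Finset.sum_congr rfl fun i hi => by rw [hx i hi, ha, norm_inner_symm]
    _ ≤ ‖a‖ ^ 2 := e.orthonormal.sum_inner_products_le a
    _ ≤ |w x| ^ 2 := pow_le_pow_left₀ (norm_nonneg _) hw0 2
    _ = w x ^ 2 := sq_abs _

/-- The bounded extension to `L²` of an operator on Schwartz functions. -/
theorem exists_extension {A : SFun N →ₗ[ℂ] Hil N} {C : ℝ} (hA : ∀ φ, ‖A φ‖ ≤ C * ‖vec φ‖) :
    ∃ K : Hil N →L[ℂ] Hil N, ∀ φ, K (vec φ) = A φ :=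
  ⟨A.extendOfNorm (vecL N : SFun N →ₗ[ℂ] Hil N), fun φ =>
    LinearMap.extendOfNorm_eq denseRange_vec ⟨C, hA⟩ φ⟩

theorem exists_isHilbertSchmidt_resolvent {m : ℕ} (hm : N < m) : ∃ K : Hil N →L[ℂ] Hil N,
    IsHilbertSchmidt K ∧ ∀ φ, K (vec φ) = vec ((invOp N 1 ^ m * momInv N ^ m) φ) := by
  obtain ⟨C, hC, h⟩ := mul_mem (pow_mem (invOp_mem_boundedEnd (N := N) 1) m)
    (pow_mem (momInv_mem_boundedEnd (N := N)) m)
  obtain ⟨K, hK⟩ := exists_extension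
    (A := (vecL N ∘L (invOp N 1 ^ m * momInv N ^ m) : SFun N →ₗ[ℂ] Hil N)) h
  refine ⟨K, ?_, hK⟩
  obtain ⟨c, hc, h1⟩ := exists_norm_momInv_pow_apply_le hm
  refine isHilbertSchmidt_of_pointwise (w := fun x => c * resolvent N 1 x ^ m) hK ?_ fun φ x => ?_
  · simp_rw [mul_pow]
    exact (integrable_resolvent_pow_sq le_rfl hm).const_mul _
  · rw [mul_apply_eq_comp, invOp_pow_apply, norm_mul, Complex.norm_real,
      Real.norm_of_nonneg (pow_nonneg (resolvent_nonneg 1 x) m), mul_comm c, mul_assoc]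
    exact mul_le_mul_of_nonneg_left (h1 φ x) (pow_nonneg (resolvent_nonneg 1 x) m)

end Sobolev

/-! ### Regularity -/

section Regularity

open Filter Topology

variable {N : ℕ}

theorem isFormalAdjoint_invOp (c : ℝ) : IsFormalAdjoint (invOp N c) (invOp N c) := fun ψ φ => by
  rw [inner_vec, inner_vec]
  refine integral_congr_ae (Eventually.of_forall fun x => ?_)
  simp only [invOp_apply, RCLike.inner_apply, map_mul, Complex.conj_ofReal]
  ring

theorem isFormalAdjoint_momInv : IsFormalAdjoint (momInv N) (momInv N) :=
  (isFormalAdjoint_invOp _).fourierConj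

theorem momSq_pow_mul_posSq_pow_mul (n k : ℕ) :
    (momSq N ^ n * posSq N 1 ^ k) * (invOp N 1 ^ k * momInv N ^ n) = 1 := by
  have h1 : Commute (posSq N 1) (invOp N 1) :=
    (posSq_mul_invOp 1).trans (invOp_mul_posSq 1).symm
  have h2 : Commute (momSq N) (momInv N) := momSq_mul_momInv.trans momInv_mul_momSq.symm
  rw [mul_assoc, ← mul_assoc (posSq N 1 ^ k), ← h1.mul_pow, posSq_mul_invOp, one_pow, one_mul,
    ← h2.mul_pow, momSq_mul_momInv, one_pow]

theorem exists_inner_eq {M : SchwartzEnd N} {f : Hil N} {C : ℝ}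
    (h : ∀ ψ, ‖inner ℂ (vec (M ψ)) f‖ ≤ C * ‖vec ψ‖) :
    ∃ g : Hil N, ∀ ψ, inner ℂ (vec (M ψ)) f = inner ℂ (vec ψ) g := by
  let L : SFun N →ₗ[ℂ] ℂ := (innerSL ℂ f ∘L vecL N ∘L M : SFun N →ₗ[ℂ] ℂ)
  have hL : ∀ ψ, ‖L ψ‖ ≤ C * ‖vec ψ‖ := fun ψ => by
    refine le_of_eq_of_le ?_ (h ψ)
    exact norm_inner_symm (𝕜 := ℂ) f (vec (M ψ))
  let E := L.extendOfNorm (vecL N : SFun N →ₗ[ℂ] Hil N)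
  refine ⟨(InnerProductSpace.toDual ℂ (Hil N)).symm E, fun ψ => ?_⟩
  have h1 : inner ℂ ((InnerProductSpace.toDual ℂ (Hil N)).symm E) (vec ψ) =
      inner ℂ f (vec (M ψ)) := by
    rw [InnerProductSpace.toDual_symm_apply]
    exact LinearMap.extendOfNorm_eq denseRange_vec ⟨C, hL⟩ ψ
  rw [← inner_conj_symm, ← h1, inner_conj_symm]

/-- A vector in the domain of the adjoints of all polynomials in position and momentum is a
Schwartz function. -/
theorem exists_vec_eq {f : Hil N}
    (h : ∀ M ∈ weylAlgebra N, ∃ C, ∀ ψ, ‖inner ℂ (vec (M ψ)) f‖ ≤ C * ‖vec ψ‖) :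
    ∃ χ : SFun N, f = vec χ := by
  have h' : ∀ M ∈ weylAlgebra N, ∃ g : Hil N, ∀ ψ, inner ℂ (vec (M ψ)) f = inner ℂ (vec ψ) g :=
    fun M hM => (h M hM).elim fun C hC => exists_inner_eq hC
  have hX : ∀ n k : ℕ, ∃ u : Hil N, ∀ ψ,
      inner ℂ (vec ((momSq N ^ n * posSq N 1 ^ k) ψ)) f = inner ℂ (vec ψ) u := fun n k =>
    h' _ (mul_mem (pow_mem momSq_mem_weylAlgebra n) (pow_mem (posSq_mem_weylAlgebra 1) k))
  choose u hu using hX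
  -- With `X = momSq N ^ n * posSq N 1 ^ k`, the vector `u n k` is `X* f`, and `momInv N ^ n * invOp
  -- N 1 ^ k` inverts `X*`. Applied to Schwartz functions near `u n k` it yields approximants of
  -- `f`. The iterated limit in `n`, then `k`, lets one filter serve all polynomials `M`.
  let l : Filter (SFun N) := atTop.bind fun n : ℕ => atTop.bind fun k : ℕ =>
    map (momInv N ^ n * invOp N 1 ^ k) (comap (vecL N) (𝓝 (u n k)))
  have hcomap : ∀ v : Hil N, (comap (vecL N) (𝓝 v)).NeBot := fun v =>
    comap_neBot fun t ht => by
      obtain ⟨_, h1, ψ, rfl⟩ := mem_closure_iff_nhds.1 (denseRange_vec v) t ht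
      exact ⟨ψ, h1⟩
  have hl : l.NeBot := by
    rw [neBot_iff]
    intro h0
    have h1 : ∀ᶠ _ in l, False := by rw [h0]; exact eventually_bot
    rw [eventually_bind] at h1
    obtain ⟨n, h1⟩ := h1.exists
    rw [eventually_bind] at h1
    obtain ⟨k, h1⟩ := h1.exists
    rw [eventually_map] at h1
    obtain ⟨ψ, hψ⟩ := h1.exists
    exact hψ
  have hadj : ∀ n k : ℕ, IsFormalAdjoint (invOp N 1 ^ k * momInv N ^ n)
      (momInv N ^ n * invOp N 1 ^ k) := fun n k =>
    ((isFormalAdjoint_invOp 1).pow k).mul (isFormalAdjoint_momInv.pow n)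
  have hlim : ∀ M ∈ weylAlgebra N, ∃ g, Tendsto (fun φ => vec (M φ)) l (𝓝 g) ∧
      (M = 1 → g = f) := by
    intro M hM
    obtain ⟨M', hM', hMM'⟩ := exists_formalAdjoint hM
    obtain ⟨g, hg⟩ := h' M' hM'
    refine ⟨g, ?_, ?_⟩
    · intro U hU
      rw [mem_map]
      change ∀ᶠ φ in l, vec (M φ) ∈ U
      rw [eventually_bind]
      filter_upwards [eventually_resolvent_mul_mem_boundedEnd hM'] with n hn
      rw [eventually_bind]
      filter_upwards [hn] with k hk
      rw [eventually_map]
      obtain ⟨C, hC, hB⟩ := hk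
      -- The operator applied to `ψ` is the formal adjoint of `X⁻¹ M'`, which is bounded in `L²` for
      -- these `n` and `k`. Its extension sends `u n k` to `g`, the weak value of `M f`.
      have hbound : ∀ ψ, ‖vec (M ((momInv N ^ n * invOp N 1 ^ k) ψ)) - g‖ ≤
          C * ‖vec ψ - u n k‖ := by
        intro ψ
        refine norm_le_of_inner_vec (by positivity) fun χ => ?_
        have h1 : inner ℂ (vec χ) (vec (M ((momInv N ^ n * invOp N 1 ^ k) ψ)) - g) =
            inner ℂ (vec ((invOp N 1 ^ k * momInv N ^ n * M') χ)) (vec ψ - u n k) := by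
          rw [inner_sub_right, inner_sub_right, ← hMM'.symm, ← hadj, ← hu, ← hg]
          congr 3
          rw [← mul_apply_eq_comp, ← mul_assoc, momSq_pow_mul_posSq_pow_mul, one_mul]
        rw [h1]
        refine (norm_inner_le_norm _ _).trans ?_
        refine (mul_le_mul_of_nonneg_right (hB χ) (norm_nonneg _)).trans_eq ?_
        ring
      have ht : Tendsto (fun ψ => vec (M ((momInv N ^ n * invOp N 1 ^ k) ψ)))
          (comap (vecL N) (𝓝 (u n k))) (𝓝 g) := by
        rw [tendsto_iff_norm_sub_tendsto_zero]
        refine squeeze_zero (fun _ => norm_nonneg _) hbound ?_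
        have h1 : Tendsto (fun ψ : SFun N => vec ψ) (comap (vecL N) (𝓝 (u n k))) (𝓝 (u n k)) :=
          tendsto_comap
        have h2 := ((tendsto_iff_norm_sub_tendsto_zero.1 h1).const_mul C)
        rwa [mul_zero] at h2
      exact ht hU
    · rintro rfl
      refine eq_of_inner_vec fun ψ => ?_
      have h1 : vec (M' ψ) = vec ψ := eq_of_inner_vec fun χ => (hMM' χ ψ).symm
      rw [← hg, h1]
  have hc : Cauchy l := by
    refine ⟨hl, ?_⟩
    rw [uniformity_eq_comap_nhds_zero, ← tendsto_iff_comap]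
    refine tendsto_zero_of_weylAlgebra fun M hM => ?_
    obtain ⟨g, hg, -⟩ := hlim M hM
    have h1 := (hg.comp tendsto_snd).sub (hg.comp (tendsto_fst (f := l) (g := l)))
    rw [sub_self] at h1
    refine h1.congr fun p => ?_
    rw [map_sub, vec_sub]
    rfl
  obtain ⟨χ, hχ⟩ := CompleteSpace.complete hc
  obtain ⟨g, hg, hgf⟩ := hlim 1 (one_mem _)
  refine ⟨χ, ?_⟩
  rw [← hgf rfl]
  exact tendsto_nhds_unique hg (((vecL N).continuous.tendsto χ).mono_left hχ)

end Regularity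

/-! ### Products of Schwartz operators with polynomials -/

section Sandwich

open Filter Topology

variable {N : ℕ}

instance isTopologicalAddGroup_sOp : IsTopologicalAddGroup (SOp N) :=
  (withSeminorms_sOp N).topologicalAddGroup

theorem opSeminorm_apply (m) (T : SOp N) :
    opSeminorm m T = ⨆ x : UnitPair N, ‖form m T.toBounded x.1.1 x.1.2‖ := rfl

theorem form_smul_smul (m) (T : Hil N →L[ℂ] Hil N) (a b : ℂ) (ψ φ : SFun N) :
    ‖form m T (a • ψ) (b • φ)‖ = ‖a‖ * ‖b‖ * ‖form m T ψ φ‖ := by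
  simp only [form, map_smul, vec_smul, inner_smul_left, inner_smul_right, norm_mul,
    RCLike.norm_conj]
  ring

theorem norm_form_le (m) (T : SOp N) (ψ φ : SFun N) :
    ‖form m T.toBounded ψ φ‖ ≤ opSeminorm m T * (‖vec ψ‖ * ‖vec φ‖) := by
  have hz : ∀ χ : SFun N, ‖vec χ‖ = 0 → χ = 0 := fun χ h =>
    vec_injective ((norm_eq_zero.1 h).trans vec_zero.symm)
  rcases eq_or_ne ‖vec ψ‖ 0 with h1 | h1
  · rw [hz ψ h1]
    simp [form, vec_zero]
  rcases eq_or_ne ‖vec φ‖ 0 with h2 | h2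
  · rw [hz φ h2]
    simp [form, vec_zero]
  have hn : ∀ χ : SFun N, ‖vec χ‖ ≠ 0 → ‖vec (((‖vec χ‖⁻¹ : ℝ) : ℂ) • χ)‖ ≤ 1 := fun χ h => by
    rw [vec_smul, norm_smul, Complex.norm_real, norm_inv, norm_norm, inv_mul_cancel₀ h]
  have h := le_ciSup (T.isSchwartz m) ⟨(((‖vec ψ‖⁻¹ : ℝ) : ℂ) • ψ, ((‖vec φ‖⁻¹ : ℝ) : ℂ) • φ),
    hn ψ h1, hn φ h2⟩
  simp only [form_smul_smul, Complex.norm_real, norm_inv, norm_norm] at h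
  rw [← opSeminorm_apply, ← mul_inv, inv_mul_le_iff₀ (by positivity), mul_comm] at h
  exact h

theorem momMon_mem_weylAlgebra (β : Fin N → ℕ) : momMon β ∈ weylAlgebra N :=
  list_prod_mem fun x hx => by
    obtain ⟨i, rfl⟩ := (List.mem_ofFn' _ _).1 hx
    exact pow_mem (momOp_mem_weylAlgebra i) _

theorem posMon_mem_weylAlgebra (α : Fin N → ℕ) : posMon α ∈ weylAlgebra N :=
  list_prod_mem fun x hx => by
    obtain ⟨i, rfl⟩ := (List.mem_ofFn' _ _).1 hx
    exact pow_mem (posOp_mem_weylAlgebra i) _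

/-- The form `⟨M ψ | T M' φ⟩` is bounded by a continuous seminorm of `T`. -/
def IsFormBounded (M M' : SchwartzEnd N) : Prop :=
  ∃ q : SOp N → ℝ, Continuous q ∧ q 0 = 0 ∧ (∀ T, 0 ≤ q T) ∧ ∀ (T : SOp N) ψ φ,
    ‖inner ℂ (vec (M ψ)) (T.toBounded (vec (M' φ)))‖ ≤ q T * (‖vec ψ‖ * ‖vec φ‖)

/-- The defining seminorms see only the ordered monomials `P^β Q^α`. These span the Weyl algebra by
normal ordering. -/
theorem isFormBounded_of_mem_weylAlgebra {M M' : SchwartzEnd N} (hM : M ∈ weylAlgebra N)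
    (hM' : M' ∈ weylAlgebra N) : IsFormBounded M M' := by
  replace hM := weylAlgebra_le_span hM
  replace hM' := weylAlgebra_le_span hM'
  induction hM using Submodule.span_induction with
  | mem M hM =>
    obtain ⟨⟨β, α⟩, rfl⟩ := hM
    induction hM' using Submodule.span_induction with
    | mem M' hM' =>
      obtain ⟨⟨β', α'⟩, rfl⟩ := hM'
      exact ⟨opSeminorm (α, α', β, β'), (withSeminorms_sOp N).continuous_seminorm _,
        map_zero _, apply_nonneg _, fun T ψ φ => norm_form_le (α, α', β, β') T ψ φ⟩
    | zero => exact ⟨0, continuous_zero, rfl, fun _ => le_rfl, fun T ψ φ => by simp [vec_zero]⟩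
    | add x y _ _ hx hy =>
      obtain ⟨p, hp, hp0, hpn, h1⟩ := hx
      obtain ⟨q, hq, hq0, hqn, h2⟩ := hy
      refine ⟨fun T => p T + q T, hp.add hq, by simp [hp0, hq0],
        fun T => add_nonneg (hpn T) (hqn T), fun T ψ φ => ?_⟩
      rw [add_apply, vec_add, map_add, inner_add_right, add_mul]
      exact (norm_add_le _ _).trans (add_le_add (h1 T ψ φ) (h2 T ψ φ))
    | smul c x _ hx =>
      obtain ⟨p, hp, hp0, hpn, h1⟩ := hx
      refine ⟨fun T => ‖c‖ * p T, hp.const_mul _ , by simp [hp0],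
        fun T => mul_nonneg (norm_nonneg c) (hpn T), fun T ψ φ => ?_⟩
      rw [smul_apply, vec_smul, map_smul, inner_smul_right, norm_mul, mul_assoc]
      exact mul_le_mul_of_nonneg_left (h1 T ψ φ) (norm_nonneg c)
  | zero => exact ⟨0, continuous_zero, rfl, fun _ => le_rfl, fun T ψ φ => by simp [vec_zero]⟩
  | add x y _ _ hx hy =>
    obtain ⟨p, hp, hp0, hpn, h1⟩ := hx
    obtain ⟨q, hq, hq0, hqn, h2⟩ := hy
    refine ⟨fun T => p T + q T, hp.add hq, by simp [hp0, hq0],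
      fun T => add_nonneg (hpn T) (hqn T), fun T ψ φ => ?_⟩
    rw [add_apply, vec_add, inner_add_left, add_mul]
    exact (norm_add_le _ _).trans (add_le_add (h1 T ψ φ) (h2 T ψ φ))
  | smul c x _ hx =>
    obtain ⟨p, hp, hp0, hpn, h1⟩ := hx
    refine ⟨fun T => ‖c‖ * p T, hp.const_mul _ , by simp [hp0],
      fun T => mul_nonneg (norm_nonneg c) (hpn T), fun T ψ φ => ?_⟩
    rw [smul_apply, vec_smul, inner_smul_left, norm_mul, RCLike.norm_conj, mul_assoc]
    exact mul_le_mul_of_nonneg_left (h1 T ψ φ) (norm_nonneg c)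

/-- Schwartz operators map Schwartz functions to Schwartz functions. -/
theorem exists_toBounded_vec_eq (T : SOp N) (φ : SFun N) : ∃ χ, T.toBounded (vec φ) = vec χ := by
  refine exists_vec_eq fun M hM => ?_
  obtain ⟨q, -, -, -, h⟩ := isFormBounded_of_mem_weylAlgebra hM (one_mem _)
  refine ⟨q T * ‖vec φ‖, fun ψ => (h T ψ φ).trans_eq ?_⟩
  ring

/-- The operator on Schwartz functions given by a Schwartz operator. -/
def SOp.onSchwartz (T : SOp N) : SFun N →ₗ[ℂ] SFun N where
  toFun φ := (exists_toBounded_vec_eq T φ).choose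
  map_add' φ ψ := vec_injective <|
    (exists_toBounded_vec_eq T (φ + ψ)).choose_spec.symm.trans <|
      ((congrArg T.toBounded (vec_add φ ψ)).trans (map_add _ _ _)).trans <|
        (congrArg₂ (· + ·) (exists_toBounded_vec_eq T φ).choose_spec
          (exists_toBounded_vec_eq T ψ).choose_spec).trans (vec_add _ _).symm
  map_smul' c φ := vec_injective <|
    (exists_toBounded_vec_eq T (c • φ)).choose_spec.symm.trans <|
      ((congrArg T.toBounded (vec_smul c φ)).trans (map_smul _ _ _)).trans <|
        (congrArg (c • ·) (exists_toBounded_vec_eq T φ).choose_spec).trans (vec_smul _ _).symm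

theorem SOp.vec_onSchwartz (T : SOp N) (φ : SFun N) :
    vec (T.onSchwartz φ) = T.toBounded (vec φ) :=
  (exists_toBounded_vec_eq T φ).choose_spec.symm

theorem isSandwich_iff (fL fR : FreeAlgebra ℂ (Fin N ⊕ Fin N)) (T : SOp N)
    (S : Hil N →L[ℂ] Hil N) : IsSandwich fL fR T.toBounded S ↔
      ∀ φ, S (vec φ) = vec (polyOp fL (T.onSchwartz (polyOp fR φ))) := by
  refine forall_congr' fun φ => ⟨?_, fun h => ⟨_, (T.vec_onSchwartz _).symm, h⟩⟩
  rintro ⟨χ, h1, h2⟩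
  rw [← T.vec_onSchwartz] at h1
  rw [h2, vec_injective h1]

theorem IsSandwich.unique {fL fR : FreeAlgebra ℂ (Fin N ⊕ Fin N)} {T : SOp N}
    {S S' : Hil N →L[ℂ] Hil N} (h : IsSandwich fL fR T.toBounded S)
    (h' : IsSandwich fL fR T.toBounded S') : S = S' := by
  rw [isSandwich_iff] at h h'
  refine ContinuousLinearMap.ext fun u => congrFun (denseRange_vec.equalizer S.continuous
    S'.continuous (funext fun φ => ?_)) u
  exact (h φ).trans (h' φ).symm

/-- Testing against Schwartz functions moves the left polynomial to the other side as its formal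
adjoint, which leaves a bounded form. The bound `q` is chosen before `T`, as the continuity of the
trace functional requires. -/
theorem exists_isSandwich_norm_le (fL fR : FreeAlgebra ℂ (Fin N ⊕ Fin N)) :
    ∃ q : SOp N → ℝ, Continuous q ∧ q 0 = 0 ∧ ∀ T : SOp N, ∃ S : Hil N →L[ℂ] Hil N,
      IsSandwich fL fR T.toBounded S ∧ ‖S‖ ≤ q T := by
  obtain ⟨L', hL', hadj⟩ := exists_formalAdjoint (polyOp_mem_weylAlgebra fL)
  obtain ⟨q, hq, hq0, hqn, h⟩ :=
    isFormBounded_of_mem_weylAlgebra hL' (polyOp_mem_weylAlgebra fR)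
  refine ⟨q, hq, hq0, fun T => ?_⟩
  let B : SFun N →ₗ[ℂ] Hil N := (vecL N : SFun N →ₗ[ℂ] Hil N) ∘ₗ (polyOp fL : SFun N →ₗ[ℂ] SFun N) ∘ₗ
    T.onSchwartz ∘ₗ (polyOp fR : SFun N →ₗ[ℂ] SFun N)
  have hB : ∀ φ, ‖B φ‖ ≤ q T * ‖vec φ‖ := fun φ => by
    refine norm_le_of_inner_vec (mul_nonneg (hqn T) (norm_nonneg _)) fun ψ => ?_
    have h1 : inner ℂ (vec ψ) (B φ) =
        inner ℂ (vec (L' ψ)) (T.toBounded (vec (polyOp fR φ))) := by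
      rw [← T.vec_onSchwartz, hadj.symm]
      rfl
    rw [h1]
    refine (h T ψ φ).trans_eq ?_
    ring
  refine ⟨B.extendOfNorm (vecL N : SFun N →ₗ[ℂ] Hil N), ?_, ?_⟩
  · rw [isSandwich_iff]
    exact fun φ => LinearMap.extendOfNorm_eq denseRange_vec ⟨_, hB⟩ φ
  · exact ContinuousLinearMap.opNorm_le_bound _ (hqn T) fun u =>
      LinearMap.norm_extendOfNorm_apply_le denseRange_vec _ hB u

/-- The bounded extension of `f_L(Q,P) T f_R(Q,P)` as a linear function of `T`. -/
def sandwich (fL fR : FreeAlgebra ℂ (Fin N ⊕ Fin N)) : SOp N →ₗ[ℂ] (Hil N →L[ℂ] Hil N) :=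
  have hs := (exists_isSandwich_norm_le fL fR).choose_spec.2.2
  { toFun := fun T => (hs T).choose
    map_add' := fun T T' => by
      refine (hs (T + T')).choose_spec.1.unique fun φ => ?_
      obtain ⟨χ, h1, h2⟩ := (hs T).choose_spec.1 φ
      obtain ⟨χ', h1', h2'⟩ := (hs T').choose_spec.1 φ
      exact ⟨χ + χ', by rw [map_add, add_apply, h1, h1', vec_add],
        by rw [add_apply, h2, h2', map_add, vec_add]⟩
    map_smul' := fun c T => by
      refine (hs (c • T)).choose_spec.1.unique fun φ => ?_
      obtain ⟨χ, h1, h2⟩ := (hs T).choose_spec.1 φ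
      exact ⟨c • χ, by rw [map_smul, smul_apply, h1, vec_smul],
        by rw [RingHom.id_apply, smul_apply, h2, map_smul, vec_smul]⟩ }

theorem isSandwich_sandwich (fL fR : FreeAlgebra ℂ (Fin N ⊕ Fin N)) (T : SOp N) :
    IsSandwich fL fR T.toBounded (sandwich fL fR T) :=
  ((exists_isSandwich_norm_le fL fR).choose_spec.2.2 T).choose_spec.1

theorem sandwich_apply (fL fR : FreeAlgebra ℂ (Fin N ⊕ Fin N)) (T : SOp N) (φ : SFun N) :
    sandwich fL fR T (vec φ) = vec (polyOp fL (T.onSchwartz (polyOp fR φ))) :=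
  (isSandwich_iff fL fR T _).1 (isSandwich_sandwich fL fR T) φ

theorem exists_norm_sandwich_le (fL fR : FreeAlgebra ℂ (Fin N ⊕ Fin N)) :
    ∃ q : SOp N → ℝ, Continuous q ∧ q 0 = 0 ∧ ∀ T, ‖sandwich fL fR T‖ ≤ q T :=
  ⟨_, (exists_isSandwich_norm_le fL fR).choose_spec.1,
    (exists_isSandwich_norm_le fL fR).choose_spec.2.1, fun T =>
    ((exists_isSandwich_norm_le fL fR).choose_spec.2.2 T).choose_spec.2⟩

theorem invOp_pow_mul_momInv_pow_mul (n k : ℕ) :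
    (invOp N 1 ^ k * momInv N ^ n) * (momSq N ^ n * posSq N 1 ^ k) = 1 := by
  have h1 : Commute (invOp N 1) (posSq N 1) :=
    (invOp_mul_posSq 1).trans (posSq_mul_invOp 1).symm
  have h2 : Commute (momInv N) (momSq N) := momInv_mul_momSq.trans momSq_mul_momInv.symm
  rw [mul_assoc, ← mul_assoc (momInv N ^ n), ← h2.mul_pow, momInv_mul_momSq, one_pow, one_mul,
    ← h1.mul_pow, invOp_mul_posSq, one_pow]

/-- A Schwartz operator, multiplied with polynomials, is the product of a fixed Hilbert-Schmidt
operator and of another such operator. -/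
theorem exists_sandwich_eq_comp (fL fR : FreeAlgebra ℂ (Fin N ⊕ Fin N)) :
    ∃ (K : Hil N →L[ℂ] Hil N) (g : FreeAlgebra ℂ (Fin N ⊕ Fin N)), IsHilbertSchmidt K ∧
      ∀ T, sandwich fL fR T = K ∘L sandwich g fR T := by
  obtain ⟨K, hK, h⟩ := exists_isHilbertSchmidt_resolvent (N := N) (Nat.lt_succ_self N)
  -- `g` is the inverse of `K` on Schwartz functions, multiplied by `fL`. The exponent `N + 1` is
  -- what makes `K` Hilbert-Schmidt.
  obtain ⟨g, hg⟩ := exists_polyOp_eq (mul_mem (mul_mem (pow_mem momSq_mem_weylAlgebra (N + 1))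
    (pow_mem (posSq_mem_weylAlgebra 1) (N + 1))) (polyOp_mem_weylAlgebra fL))
  refine ⟨K, g, hK, fun T => (isSandwich_sandwich fL fR T).unique ?_⟩
  rw [isSandwich_iff]
  intro φ
  rw [ContinuousLinearMap.comp_apply, sandwich_apply, h, hg, ← mul_apply_eq_comp, ← mul_assoc,
    invOp_pow_mul_momInv_pow_mul, one_mul]

theorem isHilbertSchmidt_sandwich (fL fR : FreeAlgebra ℂ (Fin N ⊕ Fin N)) (T : SOp N) :
    IsHilbertSchmidt (sandwich fL fR T) := by
  obtain ⟨K, g, hK, h⟩ := exists_sandwich_eq_comp fL fR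
  rw [h]
  exact hK.comp_right _

/-- The functional `T ↦ tr (A f_L(Q,P) T f_R(Q,P))`. -/
theorem exists_temperedDistr_hasTrace {A : Hil N →L[ℂ] Hil N} (hA : IsHilbertSchmidt A)
    (fL fR : FreeAlgebra ℂ (Fin N ⊕ Fin N)) :
    ∃ Φ : TemperedDistr N, ∀ T, HasTrace (A ∘L sandwich fL fR T) (Φ T) := by
  obtain ⟨ι, e, -⟩ := id hA
  have hs : ∀ T, Summable fun i => inner ℂ (e i) ((A ∘L sandwich fL fR T) (e i)) := fun T =>
    (hasSum_trace_comp hA (isHilbertSchmidt_sandwich fL fR T) e e).summable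
  let Φ : SOp N →ₗ[ℂ] ℂ :=
    { toFun := fun T => ∑' i, inner ℂ (e i) ((A ∘L sandwich fL fR T) (e i))
      map_add' := fun T T' => by
        rw [← (hs T).tsum_add (hs T')]
        refine tsum_congr fun i => ?_
        rw [map_add, ContinuousLinearMap.comp_add, add_apply, inner_add_right]
      map_smul' := fun c T => by
        rw [RingHom.id_apply, smul_eq_mul, ← tsum_mul_left]
        refine tsum_congr fun i => ?_
        rw [map_smul, ContinuousLinearMap.comp_smul, smul_apply, inner_smul_right] }
  obtain ⟨K, g, hK, h⟩ := exists_sandwich_eq_comp fL fR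
  obtain ⟨q, hq, hq0, hqn⟩ := exists_norm_sandwich_le g fR
  let K' := ContinuousLinearMap.adjoint K
  have hsum : Summable fun j => ‖K' (e j)‖ * ‖A (e j)‖ :=
    summable_norm_mul_norm (hK.adjoint.summable e) (hA.summable e)
  have hbound : ∀ T, ‖Φ T‖ ≤ q T * ∑' j, ‖K' (e j)‖ * ‖A (e j)‖ := fun T => by
    -- Cyclicity brings the fixed factor `K` of the sandwich to the front, where it moves to `e j`
    -- as `K*`. Only the operator norm of the remaining sandwich then depends on `T`.
    have h1 : Φ T = ∑' j, inner ℂ (e j) ((sandwich fL fR T ∘L A) (e j)) :=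
      (hasSum_trace_comp hA (isHilbertSchmidt_sandwich fL fR T) e e).tsum_eq
    have h2 : ∀ j, ‖inner ℂ (e j) ((sandwich fL fR T ∘L A) (e j))‖ ≤
        q T * (‖K' (e j)‖ * ‖A (e j)‖) := fun j => by
      rw [h T, ContinuousLinearMap.comp_apply, ContinuousLinearMap.comp_apply,
        ← ContinuousLinearMap.adjoint_inner_left]
      refine (norm_inner_le_norm _ _).trans ?_
      have h3 := ((sandwich g fR T).le_opNorm (A (e j))).trans
        (mul_le_mul_of_nonneg_right (hqn T) (norm_nonneg _))
      refine (mul_le_mul_of_nonneg_left h3 (norm_nonneg _)).trans_eq ?_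
      simp only [K']
      ring
    rw [h1, ← tsum_mul_left]
    exact tsum_of_norm_bounded (hsum.mul_left (q T)).hasSum h2
  refine ⟨⟨Φ, continuous_of_continuousAt_zero Φ ?_⟩, fun T =>
    hA.hasTrace_comp (isHilbertSchmidt_sandwich fL fR T) e (hs T).hasSum⟩
  rw [ContinuousAt, map_zero]
  refine squeeze_zero_norm hbound ?_
  have := (hq.tendsto 0).mul_const (∑' j, ‖K' (e j)‖ * ‖A (e j)‖)
  rwa [hq0, zero_mul] at this

/-- Finitely many of the seminorms are bounded by the norm of a single product with polynomials. -/
theorem exists_opSeminorm_le_norm_sandwich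
    (s : Finset ((Fin N → ℕ) × (Fin N → ℕ) × (Fin N → ℕ) × (Fin N → ℕ))) :
    ∃ fL fR : FreeAlgebra ℂ (Fin N ⊕ Fin N), ∀ m ∈ s, ∃ C, 0 ≤ C ∧ ∀ T : SOp N,
      opSeminorm m T ≤ C * ‖sandwich fL fR T‖ := by
  have hmem : ∀ β α : Fin N → ℕ, momMon β * posMon α ∈ weylAlgebra N := fun β α =>
    mul_mem (momMon_mem_weylAlgebra β) (posMon_mem_weylAlgebra α)
  have h : ∀ᶠ n in atTop, ∀ m ∈ s, ∀ᶠ k in atTop,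
      invOp N 1 ^ k * momInv N ^ n * (momMon m.2.2.1 * posMon m.1) ∈ boundedEnd N ∧
      invOp N 1 ^ k * momInv N ^ n * (momMon m.2.2.2 * posMon m.2.1) ∈ boundedEnd N := by
    refine (Finset.eventually_all s).2 fun m _ => ?_
    filter_upwards [eventually_resolvent_mul_mem_boundedEnd (hmem m.2.2.1 m.1),
      eventually_resolvent_mul_mem_boundedEnd (hmem m.2.2.2 m.2.1)] with n h1 h2
    exact h1.and h2
  obtain ⟨n, hn⟩ := h.exists
  -- Finiteness of `s` allows a common `n` and `k`, hence a single `X` for all the seminorms.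
  obtain ⟨k, hk⟩ := ((Finset.eventually_all s).2 hn).exists
  have hX : momSq N ^ n * posSq N 1 ^ k ∈ weylAlgebra N :=
    mul_mem (pow_mem momSq_mem_weylAlgebra n) (pow_mem (posSq_mem_weylAlgebra 1) k)
  -- Each monomial is `X (X⁻¹ M)` with `X⁻¹ M` bounded. The `X` in the first slot of the form passes
  -- to the left of `T` as `X'`, the one in the second slot stays on its right.
  obtain ⟨X', hX', hadj⟩ := exists_formalAdjoint hX
  obtain ⟨fL, hfL⟩ := exists_polyOp_eq hX'
  obtain ⟨fR, hfR⟩ := exists_polyOp_eq hX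
  refine ⟨fL, fR, fun m hm => ?_⟩
  obtain ⟨⟨C, hC, h1⟩, ⟨C', hC', h2⟩⟩ := hk m hm
  refine ⟨C * C', by positivity, fun T => ?_⟩
  rw [opSeminorm_apply]
  refine ciSup_le fun ⟨⟨ψ, φ⟩, hψ, hφ⟩ => ?_
  have hinv : ∀ (M : SchwartzEnd N) φ, M φ = (momSq N ^ n * posSq N 1 ^ k)
      ((invOp N 1 ^ k * momInv N ^ n * M) φ) := fun M φ => by
    rw [← mul_apply_eq_comp, ← mul_assoc, momSq_pow_mul_posSq_pow_mul, one_mul]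
  have h3 : form m T.toBounded ψ φ =
      inner ℂ (vec ((invOp N 1 ^ k * momInv N ^ n * (momMon m.2.2.1 * posMon m.1)) ψ))
        (sandwich fL fR T
          (vec ((invOp N 1 ^ k * momInv N ^ n * (momMon m.2.2.2 * posMon m.2.1)) φ))) := by
    rw [sandwich_apply, hfL, hfR, ← hinv, ← hadj, ← hinv, T.vec_onSchwartz]
    rfl
  simp only
  rw [h3]
  refine (norm_inner_le_norm _ _).trans ?_
  have h4 := (h1 ψ).trans (mul_le_of_le_one_right hC hψ)
  have h5 := (h2 φ).trans (mul_le_of_le_one_right hC' hφ)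
  refine (mul_le_mul h4 (((sandwich fL fR T).le_opNorm _).trans
    (mul_le_mul_of_nonneg_left h5 (norm_nonneg _))) (norm_nonneg _) hC).trans_eq ?_
  ring

/-- Every tempered distribution on Schwartz operators is of the form
`T ↦ tr (A f_L(Q,P) T f_R(Q,P))`. -/
theorem exists_hasTrace_temperedDistr (Φ : TemperedDistr N) :
    ∃ A : Hil N →L[ℂ] Hil N, IsHilbertSchmidt A ∧ ∃ fL fR : FreeAlgebra ℂ (Fin N ⊕ Fin N),
      ∀ T, HasTrace (A ∘L sandwich fL fR T) (Φ T) := by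
  obtain ⟨s, C, -, hs⟩ := Seminorm.bound_of_continuous (withSeminorms_sOp N)
    ((normSeminorm ℂ ℂ).comp (Φ : SOp N →ₗ[ℂ] ℂ)) Φ.continuous.norm
  obtain ⟨fL, fR, h⟩ := exists_opSeminorm_le_norm_sandwich s
  choose! D hD0 hD using h
  have hbound : ∀ T, ‖(Φ : SOp N →ₗ[ℂ] ℂ) T‖ ≤ (C * ∑ m ∈ s, D m) * ‖sandwich fL fR T‖ := by
    intro T
    refine (hs T).trans ?_
    rw [smul_apply, NNReal.smul_def, smul_eq_mul, mul_assoc]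
    refine mul_le_mul_of_nonneg_left ?_ C.2
    refine Seminorm.finset_sup_apply_le
      (mul_nonneg (Finset.sum_nonneg hD0) (norm_nonneg _)) fun m hm => ?_
    refine (hD m hm T).trans (mul_le_mul_of_nonneg_right ?_ (norm_nonneg _))
    exact Finset.single_le_sum (f := D) hD0 hm
  obtain ⟨A, hA, hAT⟩ := exists_hasTrace_of_bounded (sandwich fL fR)
    (isHilbertSchmidt_sandwich fL fR) (Φ : SOp N →ₗ[ℂ] ℂ) _ hbound
  exact ⟨A, hA, fL, fR, hAT⟩

end Sandwich

end SchwartzOperators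

end

theorem mainTheorem8 (N : ℕ) :
    (∀ (fL fR : FreeAlgebra ℂ (Fin N ⊕ Fin N)) (T : SchwartzOperators.SOp N),
      ∃! S : SchwartzOperators.Hil N →L[ℂ] SchwartzOperators.Hil N,
        SchwartzOperators.IsSandwich fL fR T.toBounded S) ∧
    (∀ A : SchwartzOperators.Hil N →L[ℂ] SchwartzOperators.Hil N,
      SchwartzOperators.IsHilbertSchmidt A →
      ∀ fL fR : FreeAlgebra ℂ (Fin N ⊕ Fin N),
        ∃ Φ : SchwartzOperators.TemperedDistr N,
          ∀ (T : SchwartzOperators.SOp N)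
            (S : SchwartzOperators.Hil N →L[ℂ] SchwartzOperators.Hil N),
            SchwartzOperators.IsSandwich fL fR T.toBounded S →
              SchwartzOperators.HasTrace (A ∘L S) (Φ T)) ∧
    (∀ Φ : SchwartzOperators.TemperedDistr N,
      ∃ A : SchwartzOperators.Hil N →L[ℂ] SchwartzOperators.Hil N,
        SchwartzOperators.IsHilbertSchmidt A ∧
        ∃ fL fR : FreeAlgebra ℂ (Fin N ⊕ Fin N),
          ∀ (T : SchwartzOperators.SOp N)
            (S : SchwartzOperators.Hil N →L[ℂ] SchwartzOperators.Hil N),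
            SchwartzOperators.IsSandwich fL fR T.toBounded S →
              SchwartzOperators.HasTrace (A ∘L S) (Φ T)) := by
  refine ⟨fun fL fR T => ⟨_, SchwartzOperators.isSandwich_sandwich fL fR T, fun S hS =>
    hS.unique (SchwartzOperators.isSandwich_sandwich fL fR T)⟩, fun A hA fL fR => ?_, fun Φ => ?_⟩
  · obtain ⟨Φ, h⟩ := SchwartzOperators.exists_temperedDistr_hasTrace hA fL fR
    refine ⟨Φ, fun T S hS => ?_⟩
    rw [hS.unique (SchwartzOperators.isSandwich_sandwich fL fR T)]
    exact h T
  · obtain ⟨A, hA, fL, fR, h⟩ := SchwartzOperators.exists_hasTrace_temperedDistr Φ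
    refine ⟨A, hA, fL, fR, fun T S hS => ?_⟩
    rw [hS.unique (SchwartzOperators.isSandwich_sandwich fL fR T)]
    exact h T
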